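/- All weighted graphs are finite simple graphs with a positive real weight on each edge; the rank of a weighted graph $G_w$ is the rank of its adjacency matrix, whose $(i,j)$ entry is the weight of the edge $v_iv_j$ if $v_i,v_j$ are adjacent and $0$ otherwise. A graph is bicyclic if it is connected and its number of edges equals its number of vertices plus $1$; a pendant is a vertex of degree $1$. Isomorphisms of weighted graphs preserve the weights. For $p,l,q\ge 0$, at most one of them $0$, let $\theta(p,l,q)_w$ be the union of three internally disjoint paths from a vertex $u$ to a vertex $v$, with $p$, $l$, $q$ internal vertices and with edge weights, read from $u$ to $v$, $a_1,\dots,a_{p+1}$; $b_1,\dots,b_{l+1}$; $c_1,\dots,c_{q+1}$, respectively. For $p,q\ge 3$ and $l\ge 1$, let $\infty(p,l,q)_w$ be obtained from two disjoint cycles of lengths $p$ and $q$ and a path $v_1\cdots v_l$ by identifying a vertex of the first cycle with $v_1$ and a vertex of the second cycle with $v_l$; the edge weights, in cyclic order starting at the identified vertex, are $a_1,\dots,a_p$ on the first cycle and $b_1,\dots,b_q$ on the second, and $c_1,\dots,c_{l-1}$ along the path. All these weights are positive. **Theorem 5.3.** Let $G_w$ be a weighted bicyclic graph without pendants. Then $G_w$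 has rank $4$ if and only if it is isomorphic to one of the following weighted graphs, for some choice of positive weights satisfying the stated condition: 1. $\infty(4,1,4)_w$ with $a_1a_3=a_2a_4$ and $b_1b_3=b_2b_4$; 2. $\theta(1,1,1)_w$ with $a_2b_1\neq a_1b_2$ or $a_2c_1\neq a_1c_2$; 3. $\theta(1,0,1)_w$ with $a_2c_1\neq a_1c_2$; 4. $\theta(1,0,2)_w$ with $b_1c_2=c_1c_3$; 5. $\theta(2,0,2)_w$ with $a_2b_1c_2-a_1a_3c_2-a_2c_1c_3=0$. -/

import Mathlib

/-- A simple graph on `V` with a positive weight on each edge.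
The values of `weight` off the edge set are irrelevant. -/
structure WeightedGraph (V : Type*) where
  graph : SimpleGraph V
  weight : Sym2 V → ℝ
  weight_pos : ∀ e ∈ graph.edgeSet, 0 < weight e

namespace WeightedGraph

open Classical in
/-- The adjacency matrix: the weight of the edge `ij` if `i` and `j` are adjacent, and `0`
otherwise. -/
noncomputable def adjMatrix {V : Type*} (G : WeightedGraph V) : Matrix V V ℝ :=
  Matrix.of fun i j => if G.graph.Adj i j then G.weight s(i, j) else 0

/-- The rank of a weighted graph is the rank of its adjacency matrix. -/
noncomputable def rank {V : Type*} [Fintype V] (G : WeightedGraph V) : ℕ :=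
  G.adjMatrix.rank

/-- Bicyclic: connected, and the number of edges is the number of vertices plus one. -/
def IsBicyclic {V : Type*} (G : WeightedGraph V) : Prop :=
  G.graph.Connected ∧ Nat.card G.graph.edgeSet = Nat.card V + 1

/-- Some vertex is a pendant, i.e. has exactly one neighbour. -/
def HasPendant {V : Type*} (G : WeightedGraph V) : Prop :=
  ∃ v : V, (G.graph.neighborSet v).ncard = 1

/-- Isomorphism of weighted graphs: a graph isomorphism that preserves the edge weights. -/
def IsIsomorphic {V W : Type*} (G : WeightedGraph V) (H : WeightedGraph W) : Prop :=
  ∃ φ : G.graph ≃g H.graph,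
    ∀ u v : V, G.graph.Adj u v → H.weight s(φ u, φ v) = G.weight s(u, v)

open Classical in
/-- The weighted graph on `V` with edges `e i` of weight `w i`, where `e` lists each edge once. -/
noncomputable def ofEdges {V ι : Type*} [Fintype ι] (e : ι → Sym2 V)
    (w : ι → {x : ℝ // 0 < x}) : WeightedGraph V where
  graph := SimpleGraph.fromEdgeSet (Set.range e)
  weight x := ∑ i, if e i = x then (w i : ℝ) else 0
  weight_pos x hx := by
    rw [SimpleGraph.edgeSet_fromEdgeSet] at hx
    obtain ⟨i, rfl⟩ := hx.1
    refine Finset.sum_pos' (fun j _ => ?_) ⟨i, Finset.mem_univ _, ?_⟩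
    · split_ifs
      · exact (w j).2.le
      · exact le_rfl
    · rw [if_pos rfl]
      exact (w i).2

/-- The vertices `s, f 0, …, f (k - 1), t` of a path or (if `s = t`) of a cycle, in this order:
number `0` is `s`, numbers `1, …, k` are the internal vertices and number `k + 1` is `t`. -/
def walkVertex {V : Type*} {k : ℕ} (s t : V) (f : Fin k → V) (i : ℕ) : V :=
  if i = 0 then s else if h : i - 1 < k then f ⟨i - 1, h⟩ else t

/-- The vertices of `θ(p,l,q)`: the common end vertices `u`, `v` of the three paths, and the
`p`, `l`, `q` internal vertices of the three paths. -/
inductive ThetaVertex (p l q : ℕ) : Type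
  | u : ThetaVertex p l q
  | v : ThetaVertex p l q
  | x : Fin p → ThetaVertex p l q
  | y : Fin l → ThetaVertex p l q
  | z : Fin q → ThetaVertex p l q

/-- The edges of `θ(p,l,q)`, numbered from `u` to `v` along each of the three paths. -/
def thetaEdge (p l q : ℕ) :
    Fin (p + 1) ⊕ Fin (l + 1) ⊕ Fin (q + 1) → Sym2 (ThetaVertex p l q)
  | .inl i => s(walkVertex .u .v .x i, walkVertex .u .v .x (i + 1))
  | .inr (.inl i) => s(walkVertex .u .v .y i, walkVertex .u .v .y (i + 1))
  | .inr (.inr i) => s(walkVertex .u .v .z i, walkVertex .u .v .z (i + 1))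

/-- The weighted graph `θ(p,l,q)` (meant for `p, l, q` of which at most one is `0`): three
internally disjoint paths from `u` to `v` with `p`, `l`, `q` internal vertices, whose edge weights,
read from `u` to `v`, are `a 0, …, a p`, then `b 0, …, b l`, then `c 0, …, c q`. -/
noncomputable def theta (p l q : ℕ) (a : Fin (p + 1) → {x : ℝ // 0 < x})
    (b : Fin (l + 1) → {x : ℝ // 0 < x}) (c : Fin (q + 1) → {x : ℝ // 0 < x}) :
    WeightedGraph (ThetaVertex p l q) :=
  ofEdges (thetaEdge p l q) (Sum.elim a (Sum.elim b c))

/-- The vertices of `∞(p,l,q)`: the `l` vertices of the path, and the remaining `p - 1` and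
`q - 1` vertices of the two cycles. -/
inductive InftyVertex (p l q : ℕ) : Type
  | path : Fin l → InftyVertex p l q
  | x : Fin (p - 1) → InftyVertex p l q
  | y : Fin (q - 1) → InftyVertex p l q

/-- The first vertex of the path of `∞(p,l,q)`; it lies on the first cycle. -/
def inftyFirst (p l q : ℕ) [NeZero l] : InftyVertex p l q :=
  .path ⟨0, NeZero.pos l⟩

/-- The last vertex of the path of `∞(p,l,q)`; it lies on the second cycle. -/
def inftyLast (p l q : ℕ) [NeZero l] : InftyVertex p l q :=
  .path ⟨l - 1, Nat.sub_lt (NeZero.pos l) one_pos⟩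

/-- The edges of `∞(p,l,q)`: those of the first cycle in cyclic order starting at the first vertex
of the path, those of the second cycle in cyclic order starting at the last vertex of the path, and
those of the path in order. -/
def inftyEdge (p l q : ℕ) [NeZero l] :
    Fin p ⊕ Fin q ⊕ Fin (l - 1) → Sym2 (InftyVertex p l q)
  | .inl i => s(walkVertex (inftyFirst p l q) (inftyFirst p l q) .x i,
      walkVertex (inftyFirst p l q) (inftyFirst p l q) .x (i + 1))
  | .inr (.inl i) => s(walkVertex (inftyLast p l q) (inftyLast p l q) .y i,
      walkVertex (inftyLast p l q) (inftyLast p l q) .y (i + 1))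
  | .inr (.inr i) => s(.path ⟨i, by omega⟩, .path ⟨i + 1, by omega⟩)

/-- The weighted graph `∞(p,l,q)` (meant for `p, q ≥ 3` and `l ≥ 1`): two disjoint cycles of
lengths `p` and `q` joined by a path with `l` vertices (sharing one vertex if `l = 1`). The edge
weights are `a 0, …, a (p - 1)` in cyclic order around the first cycle, starting at its vertex on
the path, `b 0, …, b (q - 1)` in the same way around the second cycle, and `c 0, …, c (l - 2)`
along the path. -/
noncomputable def infty (p l q : ℕ) [NeZero l] (a : Fin p → {x : ℝ // 0 < x})
    (b : Fin q → {x : ℝ // 0 < x}) (c : Fin (l - 1) → {x : ℝ // 0 < x}) :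
    WeightedGraph (InftyVertex p l q) :=
  ofEdges (inftyEdge p l q) (Sum.elim a (Sum.elim b c))

end WeightedGraph

/-! The argument separates the shape of the graph from its weights.

Shape. By the handshake identity the excesses `deg - 2` sum to 2. Without pendants each excess is
nonnegative, so either one vertex has degree 4 or two vertices have degree 3, and all others have
degree 2 (`degrees_of_bicyclic`). If the rank is below 5, no induced subgraph on 5 or 6 vertices is
nonsingular. For every choice of positive weights the following are nonsingular: a triangle plus an
edge with one end off the triangle and its neighbours, two triangles sharing a vertex, the 5-cycle,
the 6-cycle, and any 6-vertex graph reducible to nothing by deleting pendant edges with both ends.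
Following the degree-2 vertices away from a branch vertex, these obstructions make every path close
up at once. Only the five underlying graphs of the theorem survive (`exists_infty_of_ncard_four`,
`exists_theta_of_adj`, `exists_theta_of_not_adj`).

Weights. On each of the five graphs, rank 4 is equivalent to the stated condition, by an explicit
matrix. Lower bounds come from principal submatrices with trivial kernel (the lemma below), upper
bounds from a factorization through few rows (`Matrix.rank_le_of_eq_mul`). These equivalences turn
the shape into the condition, and also prove the converse. -/

theorem Matrix.le_rank_of_submatrix_injective {V : Type*} [Fintype V] {k : ℕ} (A : Matrix V V ℝ)
    (f : Fin k → V)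
    (h : ∀ x : Fin k → ℝ, (∀ i, ∑ j, A (f i) (f j) * x j = 0) → x = 0) : k ≤ A.rank := by
  have hinj : Function.Injective (A.submatrix f f).mulVec := by
    have : Function.Injective (A.submatrix f f).mulVecLin := by
      rw [← LinearMap.ker_eq_bot, LinearMap.ker_eq_bot']
      intro x hx
      exact h x fun i => by simpa [Matrix.mulVec, dotProduct] using congrFun hx i
    exact this
  have h1 : (A.submatrix f f).rank = k := by
    rw [Matrix.rank_of_isUnit _ (Matrix.mulVec_injective_iff_isUnit.1 hinj), Fintype.card_fin]
  rw [← h1]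
  exact A.rank_submatrix_le f f

namespace WeightedGraph

/-! ### Induced subgraphs that force rank at least 5 -/

section Obstructions

variable {V : Type*}

theorem adjMatrix_pos {G : WeightedGraph V} {i j : V} (h : G.graph.Adj i j) :
    0 < G.adjMatrix i j := by
  simpa [adjMatrix, h] using G.weight_pos s(i, j) h

theorem adjMatrix_eq_zero {G : WeightedGraph V} {i j : V} (h : ¬ G.graph.Adj i j) :
    G.adjMatrix i j = 0 := by
  simp [adjMatrix, h]

theorem adjMatrix_self (G : WeightedGraph V) (i : V) : G.adjMatrix i i = 0 :=
  adjMatrix_eq_zero (SimpleGraph.irrefl _)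

theorem adjMatrix_comm (G : WeightedGraph V) (i j : V) : G.adjMatrix i j = G.adjMatrix j i := by
  simp only [adjMatrix, Matrix.of_apply]
  rw [G.graph.adj_comm i j, Sym2.eq_swap (a := i) (b := j)]

variable [Fintype V] {G : WeightedGraph V}

/-- Three edges `p₁p₂`, `p₃p₄`, `p₅p₆` that can be removed one after another together with a
pendant vertex. -/
theorem six_le_rank_of_pendant_elimination {p₁ p₂ p₃ p₄ p₅ p₆ : V}
    (h12 : G.graph.Adj p₁ p₂) (h34 : G.graph.Adj p₃ p₄) (h56 : G.graph.Adj p₅ p₆)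
    (h13 : ¬ G.graph.Adj p₁ p₃) (h14 : ¬ G.graph.Adj p₁ p₄) (h15 : ¬ G.graph.Adj p₁ p₅)
    (h16 : ¬ G.graph.Adj p₁ p₆) (h35 : ¬ G.graph.Adj p₃ p₅) (h36 : ¬ G.graph.Adj p₃ p₆) :
    6 ≤ G.rank := by
  refine Matrix.le_rank_of_submatrix_injective _ ![p₁, p₂, p₃, p₄, p₅, p₆] fun x hx => ?_
  have e0 := hx 0
  have e1 := hx 1
  have e2 := hx 2
  have e3 := hx 3
  have e4 := hx 4
  have e5 := hx 5
  simp only [Fin.sum_univ_six, Matrix.cons_val] at e0 e1 e2 e3 e4 e5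
  rw [G.adjMatrix_comm p₂ p₁] at e1
  rw [G.adjMatrix_comm p₃ p₁] at e2
  rw [G.adjMatrix_comm p₄ p₁, G.adjMatrix_comm p₄ p₃] at e3
  rw [G.adjMatrix_comm p₅ p₁, G.adjMatrix_comm p₅ p₃] at e4
  rw [G.adjMatrix_comm p₆ p₁, G.adjMatrix_comm p₆ p₃, G.adjMatrix_comm p₆ p₅] at e5
  simp only [adjMatrix_self, adjMatrix_eq_zero h13, adjMatrix_eq_zero h14, adjMatrix_eq_zero h15,
    adjMatrix_eq_zero h16, adjMatrix_eq_zero h35, adjMatrix_eq_zero h36] at e0 e1 e2 e3 e4 e5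
  -- The rows of `p₁`, `p₃`, `p₅` kill the coordinates of `p₂`, `p₄`, `p₆` in turn; the rows of
  -- `p₆`, `p₄`, `p₂` then kill the rest in reverse order.
  have x1 : x 1 = 0 := by simpa [(adjMatrix_pos h12).ne'] using e0
  have x3 : x 3 = 0 := by simpa [(adjMatrix_pos h34).ne', x1] using e2
  have x5 : x 5 = 0 := by simpa [(adjMatrix_pos h56).ne', x1, x3] using e4
  have x4 : x 4 = 0 := by simpa [(adjMatrix_pos h56).ne', x1, x3, x5] using e5
  have x2 : x 2 = 0 := by simpa [(adjMatrix_pos h34).ne', x1, x3, x4, x5] using e3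
  have x0 : x 0 = 0 := by simpa [(adjMatrix_pos h12).ne', x1, x2, x3, x4, x5] using e1
  ext i
  fin_cases i <;> assumption

/-- In the induced subgraph `m` is pendant at `z`, so both can be eliminated whatever the
adjacencies of `z` to the triangle. What remains is a triangle, whose determinant is twice the
product of its weights. -/
theorem five_le_rank_of_triangle_edge {t₁ t₂ t₃ z m : V}
    (h12 : G.graph.Adj t₁ t₂) (h13 : G.graph.Adj t₁ t₃) (h23 : G.graph.Adj t₂ t₃)
    (hz : G.graph.Adj z m) (hm1 : ¬ G.graph.Adj m t₁) (hm2 : ¬ G.graph.Adj m t₂)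
    (hm3 : ¬ G.graph.Adj m t₃) : 5 ≤ G.rank := by
  refine Matrix.le_rank_of_submatrix_injective _ ![t₁, t₂, t₃, z, m] fun x hx => ?_
  have e0 := hx 0
  have e1 := hx 1
  have e2 := hx 2
  have e3 := hx 3
  have e4 := hx 4
  simp only [Fin.sum_univ_five, Matrix.cons_val] at e0 e1 e2 e3 e4
  rw [G.adjMatrix_comm t₁ m] at e0
  rw [G.adjMatrix_comm t₂ m, G.adjMatrix_comm t₂ t₁] at e1
  rw [G.adjMatrix_comm t₃ m, G.adjMatrix_comm t₃ t₁, G.adjMatrix_comm t₃ t₂] at e2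
  rw [G.adjMatrix_comm m z] at e4
  simp only [adjMatrix_self, adjMatrix_eq_zero hm1, adjMatrix_eq_zero hm2,
    adjMatrix_eq_zero hm3] at e0 e1 e2 e3 e4
  have pz := (adjMatrix_pos hz).ne'
  have p12 := (adjMatrix_pos h12).ne'
  have p13 := (adjMatrix_pos h13).ne'
  have p23 := (adjMatrix_pos h23).ne'
  have x3 : x 3 = 0 := by simpa [pz] using e4
  have x0 : x 0 = 0 := by
    have : 2 * (G.adjMatrix t₁ t₂ * G.adjMatrix t₁ t₃) * x 0 = 0 := by
      rw [x3] at e0 e1 e2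
      linear_combination G.adjMatrix t₁ t₃ * e1 + G.adjMatrix t₁ t₂ * e2
        - G.adjMatrix t₂ t₃ * e0
    simpa [p12, p13] using this
  have x1 : x 1 = 0 := by simpa [p23, x0, x3] using e2
  have x2 : x 2 = 0 := by simpa [p23, x0, x3] using e1
  have x4 : x 4 = 0 := by simpa [pz, x0, x1, x2, x3] using e3
  ext i
  fin_cases i <;> assumption

/-- Two triangles with a common vertex. -/
theorem five_le_rank_of_bowtie {u x₁ x₂ y₁ y₂ : V}
    (hx1 : G.graph.Adj u x₁) (hx2 : G.graph.Adj u x₂) (hx : G.graph.Adj x₁ x₂)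
    (hy1 : G.graph.Adj u y₁) (hy2 : G.graph.Adj u y₂) (hy : G.graph.Adj y₁ y₂)
    (h11 : ¬ G.graph.Adj x₁ y₁) (h12 : ¬ G.graph.Adj x₁ y₂)
    (h21 : ¬ G.graph.Adj x₂ y₁) (h22 : ¬ G.graph.Adj x₂ y₂) : 5 ≤ G.rank := by
  refine Matrix.le_rank_of_submatrix_injective _ ![u, x₁, x₂, y₁, y₂] fun x e => ?_
  have e0 := e 0
  have e1 := e 1
  have e2 := e 2
  have e3 := e 3
  have e4 := e 4
  simp only [Fin.sum_univ_five, Matrix.cons_val] at e0 e1 e2 e3 e4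
  rw [G.adjMatrix_comm x₁ u] at e1
  rw [G.adjMatrix_comm x₂ u, G.adjMatrix_comm x₂ x₁] at e2
  rw [G.adjMatrix_comm y₁ u, G.adjMatrix_comm y₁ x₁, G.adjMatrix_comm y₁ x₂] at e3
  rw [G.adjMatrix_comm y₂ u, G.adjMatrix_comm y₂ x₁, G.adjMatrix_comm y₂ x₂,
    G.adjMatrix_comm y₂ y₁] at e4
  simp only [adjMatrix_self, adjMatrix_eq_zero h11, adjMatrix_eq_zero h12,
    adjMatrix_eq_zero h21, adjMatrix_eq_zero h22] at e0 e1 e2 e3 e4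
  have q1 := adjMatrix_pos hx1
  have q2 := adjMatrix_pos hx2
  have q3 := adjMatrix_pos hx
  have q4 := adjMatrix_pos hy1
  have q5 := adjMatrix_pos hy2
  have q6 := adjMatrix_pos hy
  generalize G.adjMatrix u x₁ = a1 at *
  generalize G.adjMatrix u x₂ = a2 at *
  generalize G.adjMatrix x₁ x₂ = a at *
  generalize G.adjMatrix u y₁ = b1 at *
  generalize G.adjMatrix u y₂ = b2 at *
  generalize G.adjMatrix y₁ y₂ = b at *
  have x0 : x 0 = 0 := by
    have : 2 * (a1 * a2 * b + b1 * b2 * a) * x 0 = 0 := by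
      linear_combination a2 * b * e1 + a1 * b * e2 + b2 * a * e3 + b1 * a * e4 - a * b * e0
    -- Up to a nonzero factor this is the determinant: one term for each triangle matched with the
    -- opposite edge of the other. Positivity of the weights rules out cancellation.
    have hne : a1 * a2 * b + b1 * b2 * a ≠ 0 := by positivity
    simpa [hne] using this
  have x1 : x 1 = 0 := by simpa [q3.ne', x0] using e2
  have x2 : x 2 = 0 := by simpa [q3.ne', x0] using e1
  have x3 : x 3 = 0 := by simpa [q6.ne', x0] using e4
  have x4 : x 4 = 0 := by simpa [q6.ne', x0] using e3
  ext i
  fin_cases i <;> assumption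

/-- An odd cycle has no perfect matching, so only its two orientations contribute to the
determinant. They contribute equally, giving twice the product of the weights. -/
theorem five_le_rank_of_cycle_five {v₁ v₂ v₃ v₄ v₅ : V}
    (h12 : G.graph.Adj v₁ v₂) (h23 : G.graph.Adj v₂ v₃) (h34 : G.graph.Adj v₃ v₄)
    (h45 : G.graph.Adj v₄ v₅) (h15 : G.graph.Adj v₁ v₅)
    (h13 : ¬ G.graph.Adj v₁ v₃) (h14 : ¬ G.graph.Adj v₁ v₄)
    (h24 : ¬ G.graph.Adj v₂ v₄) (h25 : ¬ G.graph.Adj v₂ v₅)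
    (h35 : ¬ G.graph.Adj v₃ v₅) : 5 ≤ G.rank := by
  refine Matrix.le_rank_of_submatrix_injective _ ![v₁, v₂, v₃, v₄, v₅] fun x e => ?_
  have e0 := e 0
  have e1 := e 1
  have e2 := e 2
  have e3 := e 3
  have e4 := e 4
  simp only [Fin.sum_univ_five, Matrix.cons_val] at e0 e1 e2 e3 e4
  rw [G.adjMatrix_comm v₂ v₁] at e1
  rw [G.adjMatrix_comm v₃ v₁, G.adjMatrix_comm v₃ v₂] at e2
  rw [G.adjMatrix_comm v₄ v₁, G.adjMatrix_comm v₄ v₂, G.adjMatrix_comm v₄ v₃] at e3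
  rw [G.adjMatrix_comm v₅ v₁, G.adjMatrix_comm v₅ v₂, G.adjMatrix_comm v₅ v₃,
    G.adjMatrix_comm v₅ v₄] at e4
  simp only [adjMatrix_self, adjMatrix_eq_zero h13, adjMatrix_eq_zero h14,
    adjMatrix_eq_zero h24, adjMatrix_eq_zero h25, adjMatrix_eq_zero h35] at e0 e1 e2 e3 e4
  have q1 := (adjMatrix_pos h12).ne'
  have q2 := (adjMatrix_pos h23).ne'
  have q3 := (adjMatrix_pos h34).ne'
  have q4 := (adjMatrix_pos h45).ne'
  have q5 := (adjMatrix_pos h15).ne'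
  generalize G.adjMatrix v₁ v₂ = a at *
  generalize G.adjMatrix v₂ v₃ = b at *
  generalize G.adjMatrix v₃ v₄ = c at *
  generalize G.adjMatrix v₄ v₅ = d at *
  generalize G.adjMatrix v₁ v₅ = f at *
  have x0 : x 0 = 0 := by
    have : 2 * (a * c * f) * x 0 = 0 := by
      linear_combination c * f * e1 - b * f * e3 + b * d * e0 - a * d * e2 + a * c * e4
    simpa [q1, q3, q5] using this
  have x2 : x 2 = 0 := by simpa [q2, x0] using e1
  have x3 : x 3 = 0 := by simpa [q4, x0] using e4
  have x4 : x 4 = 0 := by simpa [q4, x0, x2] using e3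
  have x1 : x 1 = 0 := by simpa [q1, x0, x4] using e0
  ext i
  fin_cases i <;> assumption

/-- The graph is bipartite. Its 3 × 3 block has determinant, up to sign, the sum over the two
perfect matchings of their weight products; for a 6-cycle both enter with the same sign, so
positivity suffices. -/
theorem six_le_rank_of_cycle_six {v₁ v₂ v₃ v₄ v₅ v₆ : V}
    (h12 : G.graph.Adj v₁ v₂) (h23 : G.graph.Adj v₂ v₃) (h34 : G.graph.Adj v₃ v₄)
    (h45 : G.graph.Adj v₄ v₅) (h56 : G.graph.Adj v₅ v₆) (h16 : G.graph.Adj v₁ v₆)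
    (h13 : ¬ G.graph.Adj v₁ v₃) (h14 : ¬ G.graph.Adj v₁ v₄) (h15 : ¬ G.graph.Adj v₁ v₅)
    (h24 : ¬ G.graph.Adj v₂ v₄) (h25 : ¬ G.graph.Adj v₂ v₅) (h26 : ¬ G.graph.Adj v₂ v₆)
    (h35 : ¬ G.graph.Adj v₃ v₅) (h36 : ¬ G.graph.Adj v₃ v₆) (h46 : ¬ G.graph.Adj v₄ v₆) :
    6 ≤ G.rank := by
  refine Matrix.le_rank_of_submatrix_injective _ ![v₁, v₂, v₃, v₄, v₅, v₆] fun x e => ?_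
  have e0 := e 0
  have e1 := e 1
  have e2 := e 2
  have e3 := e 3
  have e4 := e 4
  have e5 := e 5
  simp only [Fin.sum_univ_six, Matrix.cons_val] at e0 e1 e2 e3 e4 e5
  rw [G.adjMatrix_comm v₂ v₁] at e1
  rw [G.adjMatrix_comm v₃ v₁, G.adjMatrix_comm v₃ v₂] at e2
  rw [G.adjMatrix_comm v₄ v₁, G.adjMatrix_comm v₄ v₂, G.adjMatrix_comm v₄ v₃] at e3
  rw [G.adjMatrix_comm v₅ v₁, G.adjMatrix_comm v₅ v₂, G.adjMatrix_comm v₅ v₃,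
    G.adjMatrix_comm v₅ v₄] at e4
  rw [G.adjMatrix_comm v₆ v₁, G.adjMatrix_comm v₆ v₂, G.adjMatrix_comm v₆ v₃,
    G.adjMatrix_comm v₆ v₄, G.adjMatrix_comm v₆ v₅] at e5
  simp only [adjMatrix_self, adjMatrix_eq_zero h13, adjMatrix_eq_zero h14, adjMatrix_eq_zero h15,
    adjMatrix_eq_zero h24, adjMatrix_eq_zero h25, adjMatrix_eq_zero h26, adjMatrix_eq_zero h35,
    adjMatrix_eq_zero h36, adjMatrix_eq_zero h46] at e0 e1 e2 e3 e4 e5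
  have q1 := adjMatrix_pos h12
  have q2 := adjMatrix_pos h23
  have q3 := adjMatrix_pos h34
  have q4 := adjMatrix_pos h45
  have q5 := adjMatrix_pos h56
  have q6 := adjMatrix_pos h16
  generalize G.adjMatrix v₁ v₂ = a at *
  generalize G.adjMatrix v₂ v₃ = b at *
  generalize G.adjMatrix v₃ v₄ = c at *
  generalize G.adjMatrix v₄ v₅ = d at *
  generalize G.adjMatrix v₅ v₆ = f at *
  generalize G.adjMatrix v₁ v₆ = g at *
  have hne : a * c * f + b * d * g ≠ 0 := by positivity
  have x0 : x 0 = 0 := by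
    have : (a * c * f + b * d * g) * x 0 = 0 := by
      linear_combination c * f * e1 - b * f * e3 + b * d * e5
    simpa [hne] using this
  have x1 : x 1 = 0 := by
    have : (a * c * f + b * d * g) * x 1 = 0 := by
      linear_combination c * f * e0 - c * g * e4 + d * g * e2
    simpa [hne] using this
  have x2 : x 2 = 0 := by simpa [q2.ne', x0] using e1
  have x4 : x 4 = 0 := by simpa [q5.ne', x0] using e5
  have x3 : x 3 = 0 := by simpa [q3.ne', x1] using e2
  have x5 : x 5 = 0 := by simpa [q6.ne', x1] using e0
  ext i
  fin_cases i <;> assumption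

end Obstructions

/-! ### Graphs given by edge lists, and invariance of the rank -/

section Isomorphism

/-- The sum already vanishes off the edge set, so the adjacency test can be dropped. Loops must be
excluded: `SimpleGraph.fromEdgeSet` discards them, whereas the sum would count them. -/
theorem ofEdges_adjMatrix {W ι : Type*} [Fintype ι] [DecidableEq (Sym2 W)] {e : ι → Sym2 W}
    (he : ∀ i, ¬ (e i).IsDiag) (w : ι → {x : ℝ // 0 < x}) (s t : W) :
    (ofEdges e w).adjMatrix s t = ∑ i, if e i = s(s, t) then (w i : ℝ) else 0 := by
  have hadj : (ofEdges e w).graph.Adj s t ↔ ∃ i, e i = s(s, t) := by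
    simp only [ofEdges, SimpleGraph.fromEdgeSet_adj, Set.mem_range, and_iff_left_iff_imp]
    rintro ⟨i, hi⟩ rfl
    exact he i (hi ▸ by simp)
  by_cases h : (ofEdges e w).graph.Adj s t
  · rw [adjMatrix, Matrix.of_apply, if_pos h]
    simp only [ofEdges]
    congr!
  · rw [adjMatrix_eq_zero h, Finset.sum_eq_zero]
    intro i _
    rw [if_neg fun hi => h (hadj.2 ⟨i, hi⟩)]

/-- An injective map of a nonempty set of vertices that sends listed edges to edges, and whose
image is closed under adjacency with no further edges, is an isomorphism. -/
theorem exists_isIsomorphic_ofEdges {V W ι : Type*} [Fintype ι] [Nonempty W]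
    {G : WeightedGraph V} (hG : G.graph.Connected) {e : ι → Sym2 W}
    (he : Function.Injective e) {g : W → V}
    (hg : Function.Injective g) (h1 : ∀ i, (e i).map g ∈ G.graph.edgeSet)
    (h2 : ∀ s w, G.graph.Adj (g s) w → ∃ t i, g t = w ∧ e i = s(s, t)) :
    ∃ w : ι → {x : ℝ // 0 < x}, G.IsIsomorphic (ofEdges e w) := by
  -- Connectedness enters here: the image is nonempty and closed under adjacency, so walks never
  -- leave it.
  have hsurj : Function.Surjective g := by
    intro v
    obtain ⟨s₀⟩ := ‹Nonempty W›
    obtain ⟨p⟩ := hG.preconnected (g s₀) v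
    suffices ∀ {a b : V}, G.graph.Walk a b → (∃ s, g s = a) → ∃ s, g s = b from
      this p ⟨s₀, rfl⟩
    intro a b p
    induction p with
    | nil => exact id
    | cons h _ ih =>
      rintro ⟨s, rfl⟩
      obtain ⟨t, -, ht, -⟩ := h2 s _ h
      exact ih ⟨t, ht⟩
  let φ : W ≃ V := Equiv.ofBijective g ⟨hg, hsurj⟩
  let w : ι → {x : ℝ // 0 < x} := fun i => ⟨G.weight ((e i).map g), G.weight_pos _ (h1 i)⟩
  have hadj : ∀ s t, (ofEdges e w).graph.Adj s t ↔ G.graph.Adj (g s) (g t) := by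
    intro s t
    simp only [ofEdges, SimpleGraph.fromEdgeSet_adj, Set.mem_range]
    constructor
    · rintro ⟨⟨i, hi⟩, -⟩
      simpa [hi] using h1 i
    · intro h
      obtain ⟨t', i, ht', hi⟩ := h2 s _ h
      obtain rfl := hg ht'
      exact ⟨⟨i, hi⟩, fun hst => G.graph.irrefl (hst ▸ h)⟩
  refine ⟨w, ⟨φ.symm, ?_⟩, ?_⟩
  · intro a b
    rw [hadj]
    change G.graph.Adj (φ (φ.symm a)) (φ (φ.symm b)) ↔ _
    simp
  · intro a b hab
    obtain ⟨s, rfl⟩ := φ.surjective a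
    obtain ⟨t, rfl⟩ := φ.surjective b
    change (ofEdges e w).weight s(φ.symm (φ s), φ.symm (φ t)) = _
    rw [φ.symm_apply_apply, φ.symm_apply_apply]
    obtain ⟨t', i, ht', hi⟩ := h2 s _ hab
    obtain rfl := hg ht'
    simp only [ofEdges]
    rw [Finset.sum_eq_single i, if_pos hi]
    · simp only [w, hi]
      rfl
    · intro j _ hj
      rw [if_neg fun h => hj (he (h.trans hi.symm))]
    · simp

theorem IsIsomorphic.exists_equiv {V W : Type*} {G : WeightedGraph V} {H : WeightedGraph W}
    (h : G.IsIsomorphic H) :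
    ∃ φ : W ≃ V, ∀ s t, G.adjMatrix (φ s) (φ t) = H.adjMatrix s t := by
  obtain ⟨φ, hφ⟩ := h
  refine ⟨φ.symm.toEquiv, fun s t => ?_⟩
  change G.adjMatrix (φ.symm s) (φ.symm t) = _
  by_cases hst : H.graph.Adj s t
  · have h' : G.graph.Adj (φ.symm s) (φ.symm t) := φ.symm.map_rel_iff.2 hst
    have := hφ _ _ h'
    simp only [RelIso.apply_symm_apply] at this
    simp [adjMatrix, hst, h', this]
  · have h' : ¬ G.graph.Adj (φ.symm s) (φ.symm t) := fun h => hst (φ.symm.map_rel_iff.1 h)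
    rw [adjMatrix_eq_zero hst, adjMatrix_eq_zero h']

theorem IsIsomorphic.rank_eq {V W : Type*} [Fintype V] {n : ℕ} {G : WeightedGraph V}
    {H : WeightedGraph W} (h : G.IsIsomorphic H) {f : Fin n → W} (hf : Function.Bijective f) :
    G.rank = (Matrix.of fun i j => H.adjMatrix (f i) (f j)).rank := by
  obtain ⟨φ, hφ⟩ := h.exists_equiv
  let ψ : Fin n ≃ V := (Equiv.ofBijective f hf).trans φ
  rw [rank, ← Matrix.rank_submatrix G.adjMatrix ψ ψ]
  congr 1
  ext i j
  exact hφ _ _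

end Isomorphism

end WeightedGraph

theorem Matrix.rank_le_of_eq_mul {n k : ℕ} {M : Matrix (Fin n) (Fin n) ℝ}
    (P : Matrix (Fin n) (Fin k) ℝ) (Q : Matrix (Fin k) (Fin n) ℝ) (h : M = P * Q) :
    M.rank ≤ k := by
  rw [h]
  exact (Matrix.rank_mul_le_left P Q).trans (Matrix.rank_le_width P)

theorem eq_zero_of_two_equations {p q r s y z : ℝ} (hne : q * r ≠ p * s)
    (e1 : p * y + r * z = 0) (e2 : q * y + s * z = 0) : y = 0 ∧ z = 0 := by
  have hne' := sub_ne_zero.2 hne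
  exact ⟨(mul_eq_zero.1 (by linear_combination r * e2 - s * e1 :
    (q * r - p * s) * y = 0)).resolve_left hne',
    (mul_eq_zero.1 (by linear_combination q * e1 - p * e2 :
    (q * r - p * s) * z = 0)).resolve_left hne'⟩

namespace WeightedGraph

/-! ### Ranks of the five explicit matrices -/

section ExplicitMatrices

variable {a0 a1 a2 a3 b0 b1 b2 b3 c0 c1 c2 : ℝ}

/-- The rank is twice that of the 2 × 3 block with rows `(a0, b0, c0)` and `(a1, b1, c1)`. As `a0`
is nonzero, the rows are proportional exactly when both minors through the first column vanish. -/
theorem rank_matrix_theta_one_one_one (ha0 : 0 < a0) :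
    Matrix.rank !![0, 0, a0, b0, c0; 0, 0, a1, b1, c1; a0, a1, 0, 0, 0; b0, b1, 0, 0, 0;
      c0, c1, 0, 0, 0] = 4 ↔ a1 * b0 ≠ a0 * b1 ∨ a1 * c0 ≠ a0 * c1 := by
  constructor
  · intro h4
    by_contra! hcon
    have : Matrix.rank !![0, 0, a0, b0, c0; 0, 0, a1, b1, c1; a0, a1, 0, 0, 0; b0, b1, 0, 0, 0;
        c0, c1, 0, 0, 0] ≤ 2 := by
      refine Matrix.rank_le_of_eq_mul !![1, 0; a1 / a0, 0; 0, a0; 0, b0; 0, c0]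
        !![0, 0, a0, b0, c0; 1, a1 / a0, 0, 0, 0] ?_
      simp
      field_simp
      grind
    omega
  · intro hne
    refine le_antisymm ?_ ?_
    · refine Matrix.rank_le_of_eq_mul
        !![1, 0, 0, 0; 0, 1, 0, 0; 0, 0, a0, a1; 0, 0, b0, b1; 0, 0, c0, c1]
        !![0, 0, a0, b0, c0; 0, 0, a1, b1, c1; 1, 0, 0, 0, 0; 0, 1, 0, 0, 0] ?_
      simp
    · rcases hne with hne | hne
      · refine Matrix.le_rank_of_submatrix_injective _ ![0, 1, 2, 3] fun x e => ?_
        have e0 := e 0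
        have e1 := e 1
        have e2 := e 2
        have e3 := e 3
        simp [Fin.sum_univ_four] at e0 e1 e2 e3
        obtain ⟨x2, x3⟩ := eq_zero_of_two_equations hne e0 e1
        obtain ⟨x0, x1⟩ := eq_zero_of_two_equations (by grind) e2 e3
        ext i
        fin_cases i <;> assumption
      · refine Matrix.le_rank_of_submatrix_injective _ ![0, 1, 2, 4] fun x e => ?_
        have e0 := e 0
        have e1 := e 1
        have e2 := e 2
        have e3 := e 3
        simp [Fin.sum_univ_four] at e0 e1 e2 e3
        obtain ⟨x2, x3⟩ := eq_zero_of_two_equations hne e0 e1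
        obtain ⟨x0, x1⟩ := eq_zero_of_two_equations (by grind) e2 e3
        ext i
        fin_cases i <;> assumption

/-- The lower right block is zero, so the determinant is the square of the minor `a0 * c1 - a1 * c0`
and does not involve `b0`. -/
theorem rank_matrix_theta_one_zero_one (ha0 : 0 < a0) :
    Matrix.rank !![0, b0, a0, c0; b0, 0, a1, c1; a0, a1, 0, 0; c0, c1, 0, 0] = 4 ↔
      a1 * c0 ≠ a0 * c1 := by
  constructor
  · intro h4 hcon
    have : Matrix.rank !![0, b0, a0, c0; b0, 0, a1, c1; a0, a1, 0, 0; c0, c1, 0, 0] ≤ 3 := by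
      refine Matrix.rank_le_of_eq_mul !![1, 0, 0; 0, 1, 0; 0, 0, 1; 0, 0, c0 / a0]
        !![0, b0, a0, c0; b0, 0, a1, c1; a0, a1, 0, 0] ?_
      simp
      field_simp
      grind
    omega
  · intro hne
    refine le_antisymm (Matrix.rank_le_width _) ?_
    refine Matrix.le_rank_of_submatrix_injective _ ![0, 1, 2, 3] fun x e => ?_
    have e0 := e 0
    have e1 := e 1
    have e2 := e 2
    have e3 := e 3
    simp [Fin.sum_univ_four] at e0 e1 e2 e3
    obtain ⟨x0, x1⟩ := eq_zero_of_two_equations (by grind) e2 e3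
    obtain ⟨x2, x3⟩ := eq_zero_of_two_equations hne (by simpa [x1] using e0)
      (by simpa [x0] using e1)
    ext i
    fin_cases i <;> assumption

/-- The determinant is `-2 * a0 * a1 * c1 * (b0 * c1 - c0 * c2)`: the triangle matched with the edge
`c1`, against the 5-cycle avoiding the edge `b0`. When it vanishes, the row of `v` depends on the
others, and deleting `v` leaves a path on four vertices, which is nonsingular. -/
theorem rank_matrix_theta_one_zero_two (ha0 : 0 < a0) (ha1 : 0 < a1) (hc1 : 0 < c1)
    (hc2 : 0 < c2) :
    Matrix.rank !![0, b0, a0, c0, 0; b0, 0, a1, 0, c2; a0, a1, 0, 0, 0; c0, 0, 0, 0, c1;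
      0, c2, 0, c1, 0] = 4 ↔ b0 * c1 = c0 * c2 := by
  constructor
  · intro h4
    by_contra hne
    have : 5 ≤ Matrix.rank !![0, b0, a0, c0, 0; b0, 0, a1, 0, c2; a0, a1, 0, 0, 0;
        c0, 0, 0, 0, c1; 0, c2, 0, c1, 0] := by
      refine Matrix.le_rank_of_submatrix_injective _ ![0, 1, 2, 3, 4] fun x e => ?_
      have e0 := e 0
      have e1 := e 1
      have e2 := e 2
      have e3 := e 3
      have e4 := e 4
      simp [Fin.sum_univ_five] at e0 e1 e2 e3 e4
      have hne' := sub_ne_zero.2 hne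
      have x0 : x 0 = 0 := by
        have : 2 * a0 * (b0 * c1 - c0 * c2) * x 0 = 0 := by
          linear_combination (b0 * c1 - c0 * c2) * e2 + a0 * c1 * e1 - a1 * c1 * e0
            - a0 * c2 * e3 + a1 * c0 * e4
        simpa [hne', ha0.ne'] using this
      have x1 : x 1 = 0 := by simpa [x0, ha1.ne'] using e2
      have x4 : x 4 = 0 := by simpa [x0, hc1.ne'] using e3
      have x3 : x 3 = 0 := by simpa [x1, hc1.ne'] using e4
      have x2 : x 2 = 0 := by simpa [x0, x1, x3, x4, ha0.ne'] using e0
      ext i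
      fin_cases i <;> assumption
    omega
  · intro h
    refine le_antisymm ?_ ?_
    · refine Matrix.rank_le_of_eq_mul !![1, 0, 0, 0;
          a1 / a0, 0, c2 / c1, - (a1 * c0 / (a0 * c1)); 0, 1, 0, 0; 0, 0, 1, 0; 0, 0, 0, 1]
        !![0, b0, a0, c0, 0; a0, a1, 0, 0, 0; c0, 0, 0, 0, c1; 0, c2, 0, c1, 0] ?_
      simp
      field_simp
      grind
    · refine Matrix.le_rank_of_submatrix_injective _ ![0, 2, 3, 4] fun x e => ?_
      have e0 := e 0
      have e1 := e 1
      have e2 := e 2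
      have e3 := e 3
      simp [Fin.sum_univ_four, ha0.ne', hc1.ne'] at e0 e1 e2 e3
      simp [e1, e3, ha0.ne', hc1.ne'] at e0 e2
      ext i
      fin_cases i <;> assumption

/-- The edges `a1` and `c1` form a nonsingular 4 × 4 block. Its Schur complement on `u`, `v` has
zero diagonal and off-diagonal entry `b0 - a0 * a2 / a1 - c0 * c2 / c1`, so the rank is 4 or 6
according to whether this entry is zero. -/
theorem rank_matrix_theta_two_zero_two (ha1 : 0 < a1) (hc1 : 0 < c1) :
    Matrix.rank !![0, b0, a0, 0, c0, 0; b0, 0, 0, a2, 0, c2; a0, 0, 0, a1, 0, 0;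
      0, a2, a1, 0, 0, 0; c0, 0, 0, 0, 0, c1; 0, c2, 0, 0, c1, 0] = 4 ↔
      a1 * b0 * c1 - a0 * a2 * c1 - a1 * c0 * c2 = 0 := by
  constructor
  · intro h4
    by_contra hne
    have : 6 ≤ Matrix.rank !![0, b0, a0, 0, c0, 0; b0, 0, 0, a2, 0, c2; a0, 0, 0, a1, 0, 0;
        0, a2, a1, 0, 0, 0; c0, 0, 0, 0, 0, c1; 0, c2, 0, 0, c1, 0] := by
      refine Matrix.le_rank_of_submatrix_injective _ ![0, 1, 2, 3, 4, 5] fun x e => ?_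
      have e0 := e 0
      have e1 := e 1
      have e2 := e 2
      have e3 := e 3
      have e4 := e 4
      have e5 := e 5
      simp [Fin.sum_univ_six] at e0 e1 e2 e3 e4 e5
      have x0 : x 0 = 0 := by
        have : (a1 * b0 * c1 - a0 * a2 * c1 - a1 * c0 * c2) * x 0 = 0 := by
          linear_combination a1 * c1 * e1 - a2 * c1 * e2 - a1 * c2 * e4
        simpa [hne] using this
      have x1 : x 1 = 0 := by
        have : (a1 * b0 * c1 - a0 * a2 * c1 - a1 * c0 * c2) * x 1 = 0 := by
          linear_combination a1 * c1 * e0 - a0 * c1 * e3 - a1 * c0 * e5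
        simpa [hne] using this
      have x3 : x 3 = 0 := by simpa [x0, ha1.ne'] using e2
      have x5 : x 5 = 0 := by simpa [x0, hc1.ne'] using e4
      have x2 : x 2 = 0 := by simpa [x1, ha1.ne'] using e3
      have x4 : x 4 = 0 := by simpa [x1, hc1.ne'] using e5
      ext i
      fin_cases i <;> assumption
    omega
  · intro h
    refine le_antisymm ?_ ?_
    · refine Matrix.rank_le_of_eq_mul !![0, a0 / a1, 0, c0 / c1; a2 / a1, 0, c2 / c1, 0;
          1, 0, 0, 0; 0, 1, 0, 0; 0, 0, 1, 0; 0, 0, 0, 1]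
        !![a0, 0, 0, a1, 0, 0; 0, a2, a1, 0, 0, 0; c0, 0, 0, 0, 0, c1; 0, c2, 0, 0, c1, 0] ?_
      simp
      field_simp
      grind
    · refine Matrix.le_rank_of_submatrix_injective _ ![2, 3, 4, 5] fun x e => ?_
      have e0 := e 0
      have e1 := e 1
      have e2 := e 2
      have e3 := e 3
      simp [Fin.sum_univ_four, ha1.ne', hc1.ne'] at e0 e1 e2 e3
      ext i
      fin_cases i <;> assumption

/-- The condition on a cycle says that the rows of the two neighbours of the centre on it are
proportional. If it fails, that cycle is nonsingular and stays so after attaching the path of two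
edges that starts along the other cycle, minus nothing but its pendant edge: rank 6. If both hold,
the rows of the first two noncentral vertices of each cycle span all rows. -/
theorem rank_matrix_infty_four_one_four (ha0 : 0 < a0) (ha1 : 0 < a1) (hb0 : 0 < b0)
    (hb1 : 0 < b1) :
    Matrix.rank !![0, a0, 0, a3, b0, 0, b3; a0, 0, a1, 0, 0, 0, 0; 0, a1, 0, a2, 0, 0, 0;
      a3, 0, a2, 0, 0, 0, 0; b0, 0, 0, 0, 0, b1, 0; 0, 0, 0, 0, b1, 0, b2;
      b3, 0, 0, 0, 0, b2, 0] = 4 ↔ a0 * a2 = a1 * a3 ∧ b0 * b2 = b1 * b3 := by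
  constructor
  · intro h4
    have hlt : ¬ 6 ≤ Matrix.rank !![0, a0, 0, a3, b0, 0, b3; a0, 0, a1, 0, 0, 0, 0;
      0, a1, 0, a2, 0, 0, 0; a3, 0, a2, 0, 0, 0, 0; b0, 0, 0, 0, 0, b1, 0;
      0, 0, 0, 0, b1, 0, b2; b3, 0, 0, 0, 0, b2, 0] := by omega
    constructor
    · by_contra hne
      refine hlt (Matrix.le_rank_of_submatrix_injective _ ![0, 1, 2, 3, 4, 5] fun x e => ?_)
      have e0 := e 0
      have e1 := e 1
      have e2 := e 2
      have e3 := e 3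
      have e4 := e 4
      have e5 := e 5
      simp [Fin.sum_univ_six, hb1.ne'] at e0 e1 e2 e3 e4 e5
      obtain ⟨x0, x2⟩ := eq_zero_of_two_equations (by grind) e1 e3
      obtain ⟨x1, x3⟩ := eq_zero_of_two_equations (p := a0) (r := a3) (fun h => hne h.symm)
        (by simpa [e5] using e0) e2
      have x5 : x 5 = 0 := by simpa [x0, hb1.ne'] using e4
      ext i
      fin_cases i <;> assumption
    · by_contra hne
      refine hlt (Matrix.le_rank_of_submatrix_injective _ ![0, 4, 5, 6, 1, 2] fun x e => ?_)
      have e0 := e 0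
      have e1 := e 1
      have e2 := e 2
      have e3 := e 3
      have e4 := e 4
      have e5 := e 5
      simp [Fin.sum_univ_six, ha1.ne'] at e0 e1 e2 e3 e4 e5
      obtain ⟨x0, x2⟩ := eq_zero_of_two_equations (by grind) e1 e3
      obtain ⟨x1, x3⟩ := eq_zero_of_two_equations (p := b0) (r := b3) (fun h => hne h.symm)
        (by simpa [e5] using e0) e2
      have x5 : x 5 = 0 := by simpa [x0, ha1.ne'] using e4
      ext i
      fin_cases i <;> assumption
  · rintro ⟨ha, hb⟩
    refine le_antisymm ?_ ?_
    · refine Matrix.rank_le_of_eq_mul !![0, a0 / a1, 0, b0 / b1; 1, 0, 0, 0; 0, 1, 0, 0;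
          a2 / a1, 0, 0, 0; 0, 0, 1, 0; 0, 0, 0, 1; 0, 0, b2 / b1, 0]
        !![a0, 0, a1, 0, 0, 0, 0; 0, a1, 0, a2, 0, 0, 0; b0, 0, 0, 0, 0, b1, 0;
          0, 0, 0, 0, b1, 0, b2] ?_
      simp
      field_simp
      grind
    · refine Matrix.le_rank_of_submatrix_injective _ ![1, 2, 4, 5] fun x e => ?_
      have e0 := e 0
      have e1 := e 1
      have e2 := e 2
      have e3 := e 3
      simp [Fin.sum_univ_four, ha1.ne', hb1.ne'] at e0 e1 e2 e3
      ext i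
      fin_cases i <;> assumption

end ExplicitMatrices

/-! ### Rank conditions for weighted graphs of the five shapes -/

section RankOfIsomorphic

variable {V : Type*} [Fintype V] {G : WeightedGraph V}

theorem IsIsomorphic.rank_theta_one_one_one {a b c : Fin 2 → {x : ℝ // 0 < x}}
    (h : G.IsIsomorphic (theta 1 1 1 a b c)) :
    G.rank = 4 ↔ (a 1 : ℝ) * b 0 ≠ a 0 * b 1 ∨ (a 1 : ℝ) * c 0 ≠ a 0 * c 1 := by
  classical
  have hd : ∀ i, ¬ (thetaEdge 1 1 1 i).IsDiag := by
    rintro (i | i | i) <;> fin_cases i <;> simp [thetaEdge, walkVertex]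
  let f : Fin 5 → ThetaVertex 1 1 1 := ![.u, .v, .x 0, .y 0, .z 0]
  have hf : Function.Bijective f := by
    constructor
    · intro i j hij
      fin_cases i <;> fin_cases j <;> first | rfl | cases hij
    · rintro (_ | _ | i | i | i)
      · exact ⟨0, rfl⟩
      · exact ⟨1, rfl⟩
      all_goals fin_cases i
      · exact ⟨2, rfl⟩
      · exact ⟨3, rfl⟩
      · exact ⟨4, rfl⟩
  have hA := ofEdges_adjMatrix hd (Sum.elim a (Sum.elim b c))
  simp [Fintype.sum_sum_type, Fin.sum_univ_succ, thetaEdge, walkVertex] at hA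
  have hM : (Matrix.of fun i j => (theta 1 1 1 a b c).adjMatrix (f i) (f j)) =
      !![0, 0, (a 0 : ℝ), b 0, c 0; 0, 0, a 1, b 1, c 1; a 0, a 1, 0, 0, 0; b 0, b 1, 0, 0, 0;
        c 0, c 1, 0, 0, 0] := by
    ext i j
    fin_cases i <;> fin_cases j <;>
      simp [f, theta, hA]
  rw [h.rank_eq hf, hM, rank_matrix_theta_one_one_one (a 0).2]

theorem IsIsomorphic.rank_theta_one_zero_one {a c : Fin 2 → {x : ℝ // 0 < x}}
    {b : Fin 1 → {x : ℝ // 0 < x}} (h : G.IsIsomorphic (theta 1 0 1 a b c)) :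
    G.rank = 4 ↔ (a 1 : ℝ) * c 0 ≠ a 0 * c 1 := by
  classical
  have hd : ∀ i, ¬ (thetaEdge 1 0 1 i).IsDiag := by
    rintro (i | i | i) <;> fin_cases i <;> simp [thetaEdge, walkVertex]
  let f : Fin 4 → ThetaVertex 1 0 1 := ![.u, .v, .x 0, .z 0]
  have hf : Function.Bijective f := by
    constructor
    · intro i j hij
      fin_cases i <;> fin_cases j <;> first | rfl | cases hij
    · rintro (_ | _ | i | i | i)
      · exact ⟨0, rfl⟩
      · exact ⟨1, rfl⟩
      all_goals fin_cases i
      · exact ⟨2, rfl⟩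
      · exact ⟨3, rfl⟩
  have hA := ofEdges_adjMatrix hd (Sum.elim a (Sum.elim b c))
  simp [Fintype.sum_sum_type, Fin.sum_univ_succ, thetaEdge, walkVertex] at hA
  have hM : (Matrix.of fun i j => (theta 1 0 1 a b c).adjMatrix (f i) (f j)) =
      !![0, (b 0 : ℝ), a 0, c 0; b 0, 0, a 1, c 1; a 0, a 1, 0, 0; c 0, c 1, 0, 0] := by
    ext i j
    fin_cases i <;> fin_cases j <;>
      simp [f, theta, hA]
  rw [h.rank_eq hf, hM, rank_matrix_theta_one_zero_one (a 0).2]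

theorem IsIsomorphic.rank_theta_one_zero_two {a : Fin 2 → {x : ℝ // 0 < x}}
    {b : Fin 1 → {x : ℝ // 0 < x}} {c : Fin 3 → {x : ℝ // 0 < x}}
    (h : G.IsIsomorphic (theta 1 0 2 a b c)) :
    G.rank = 4 ↔ (b 0 : ℝ) * c 1 = c 0 * c 2 := by
  classical
  have hd : ∀ i, ¬ (thetaEdge 1 0 2 i).IsDiag := by
    rintro (i | i | i) <;> fin_cases i <;> simp [thetaEdge, walkVertex]
  let f : Fin 5 → ThetaVertex 1 0 2 := ![.u, .v, .x 0, .z 0, .z 1]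
  have hf : Function.Bijective f := by
    constructor
    · intro i j hij
      fin_cases i <;> fin_cases j <;> first | rfl | cases hij
    · rintro (_ | _ | i | i | i)
      · exact ⟨0, rfl⟩
      · exact ⟨1, rfl⟩
      all_goals fin_cases i
      · exact ⟨2, rfl⟩
      · exact ⟨3, rfl⟩
      · exact ⟨4, rfl⟩
  have hA := ofEdges_adjMatrix hd (Sum.elim a (Sum.elim b c))
  simp [Fintype.sum_sum_type, Fin.sum_univ_succ, thetaEdge, walkVertex] at hA
  have hM : (Matrix.of fun i j => (theta 1 0 2 a b c).adjMatrix (f i) (f j)) =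
      !![0, (b 0 : ℝ), a 0, c 0, 0; b 0, 0, a 1, 0, c 2; a 0, a 1, 0, 0, 0; c 0, 0, 0, 0, c 1;
        0, c 2, 0, c 1, 0] := by
    ext i j
    fin_cases i <;> fin_cases j <;>
      simp [f, theta, hA]
  rw [h.rank_eq hf, hM, rank_matrix_theta_one_zero_two (a 0).2 (a 1).2 (c 1).2 (c 2).2]

theorem IsIsomorphic.rank_theta_two_zero_two {a c : Fin 3 → {x : ℝ // 0 < x}}
    {b : Fin 1 → {x : ℝ // 0 < x}} (h : G.IsIsomorphic (theta 2 0 2 a b c)) :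
    G.rank = 4 ↔ (a 1 : ℝ) * b 0 * c 1 - a 0 * a 2 * c 1 - a 1 * c 0 * c 2 = 0 := by
  classical
  have hd : ∀ i, ¬ (thetaEdge 2 0 2 i).IsDiag := by
    rintro (i | i | i) <;> fin_cases i <;> simp [thetaEdge, walkVertex]
  let f : Fin 6 → ThetaVertex 2 0 2 := ![.u, .v, .x 0, .x 1, .z 0, .z 1]
  have hf : Function.Bijective f := by
    constructor
    · intro i j hij
      fin_cases i <;> fin_cases j <;> first | rfl | cases hij
    · rintro (_ | _ | i | i | i)
      · exact ⟨0, rfl⟩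
      · exact ⟨1, rfl⟩
      all_goals fin_cases i
      · exact ⟨2, rfl⟩
      · exact ⟨3, rfl⟩
      · exact ⟨4, rfl⟩
      · exact ⟨5, rfl⟩
  have hA := ofEdges_adjMatrix hd (Sum.elim a (Sum.elim b c))
  simp [Fintype.sum_sum_type, Fin.sum_univ_succ, thetaEdge, walkVertex] at hA
  have hM : (Matrix.of fun i j => (theta 2 0 2 a b c).adjMatrix (f i) (f j)) =
      !![0, (b 0 : ℝ), a 0, 0, c 0, 0; b 0, 0, 0, a 2, 0, c 2; a 0, 0, 0, a 1, 0, 0;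
        0, a 2, a 1, 0, 0, 0; c 0, 0, 0, 0, 0, c 1; 0, c 2, 0, 0, c 1, 0] := by
    ext i j
    fin_cases i <;> fin_cases j <;>
      simp [f, theta, hA]
  rw [h.rank_eq hf, hM, rank_matrix_theta_two_zero_two (a 1).2 (c 1).2]

theorem IsIsomorphic.rank_infty_four_one_four {a b : Fin 4 → {x : ℝ // 0 < x}}
    {c : Fin 0 → {x : ℝ // 0 < x}} (h : G.IsIsomorphic (infty 4 1 4 a b c)) :
    G.rank = 4 ↔ (a 0 : ℝ) * a 2 = a 1 * a 3 ∧ (b 0 : ℝ) * b 2 = b 1 * b 3 := by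
  classical
  have hd : ∀ i, ¬ (inftyEdge 4 1 4 i).IsDiag := by
    rintro (i | i | i) <;> fin_cases i <;>
      simp [inftyEdge, walkVertex, inftyFirst, inftyLast]
  let f : Fin 7 → InftyVertex 4 1 4 := ![.path 0, .x 0, .x 1, .x 2, .y 0, .y 1, .y 2]
  have hf : Function.Bijective f := by
    constructor
    · intro i j hij
      fin_cases i <;> fin_cases j <;> first | rfl | cases hij
    · rintro (i | i | i) <;> fin_cases i
      · exact ⟨0, rfl⟩
      · exact ⟨1, rfl⟩
      · exact ⟨2, rfl⟩
      · exact ⟨3, rfl⟩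
      · exact ⟨4, rfl⟩
      · exact ⟨5, rfl⟩
      · exact ⟨6, rfl⟩
  have hA := ofEdges_adjMatrix hd (Sum.elim a (Sum.elim b c))
  simp [Fintype.sum_sum_type, Fin.sum_univ_succ, inftyEdge, walkVertex, inftyFirst,
    inftyLast] at hA
  have hM : (Matrix.of fun i j => (infty 4 1 4 a b c).adjMatrix (f i) (f j)) =
      !![0, (a 0 : ℝ), 0, a 3, b 0, 0, b 3; a 0, 0, a 1, 0, 0, 0, 0; 0, a 1, 0, a 2, 0, 0, 0;
        a 3, 0, a 2, 0, 0, 0, 0; b 0, 0, 0, 0, 0, b 1, 0; 0, 0, 0, 0, b 1, 0, b 2;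
        b 3, 0, 0, 0, 0, b 2, 0] := by
    ext i j
    fin_cases i <;> fin_cases j <;>
      simp [f, infty, hA]
  rw [h.rank_eq hf, hM, rank_matrix_infty_four_one_four (a 0).2 (a 1).2 (b 0).2 (b 1).2]

end RankOfIsomorphic

end WeightedGraph

namespace WeightedGraph

/-! ### Neighbourhoods and degrees in a bicyclic graph -/

section Neighbors

variable {V : Type*} {G : WeightedGraph V}

theorem exists_neighbor_of_ncard_two {x n : V} (h : (G.graph.neighborSet x).ncard = 2)
    (hn : G.graph.Adj x n) :
    ∃ m, m ≠ n ∧ G.graph.Adj x m ∧ ∀ w, G.graph.Adj x w ↔ w = n ∨ w = m := by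
  obtain ⟨p, q, hpq, hs⟩ := Set.ncard_eq_two.1 h
  have hN : ∀ w, G.graph.Adj x w ↔ w = p ∨ w = q := fun w => by
    simpa using Set.ext_iff.1 hs w
  rcases (hN n).1 hn with rfl | rfl
  · exact ⟨q, hpq.symm, (hN q).2 (.inr rfl), hN⟩
  · exact ⟨p, hpq, (hN p).2 (.inl rfl), fun w => (hN w).trans or_comm⟩

theorem exists_neighbors_of_ncard_three {u : V} (h : (G.graph.neighborSet u).ncard = 3) :
    ∃ a b c, a ≠ b ∧ a ≠ c ∧ b ≠ c ∧ ∀ w, G.graph.Adj u w ↔ w = a ∨ w = b ∨ w = c := by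
  obtain ⟨a, b, c, hab, hac, hbc, hs⟩ := Set.ncard_eq_three.1 h
  exact ⟨a, b, c, hab, hac, hbc, fun w => by simpa using Set.ext_iff.1 hs w⟩

theorem exists_neighbors_of_ncard_three' {u v : V} (h : (G.graph.neighborSet u).ncard = 3)
    (huv : G.graph.Adj u v) :
    ∃ x z, v ≠ x ∧ v ≠ z ∧ x ≠ z ∧ ∀ w, G.graph.Adj u w ↔ w = v ∨ w = x ∨ w = z := by
  obtain ⟨a, b, c, hab, hac, hbc, hs⟩ := exists_neighbors_of_ncard_three h
  rcases (hs v).1 huv with rfl | rfl | rfl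
  · exact ⟨b, c, hab, hac, hbc, hs⟩
  · exact ⟨a, c, hab.symm, hbc, hac, by grind⟩
  · exact ⟨a, b, hac.symm, hbc.symm, hab, by grind⟩

theorem exists_neighbors_of_ncard_four {u : V} (h : (G.graph.neighborSet u).ncard = 4) :
    ∃ a b c d, a ≠ b ∧ a ≠ c ∧ a ≠ d ∧ b ≠ c ∧ b ≠ d ∧ c ≠ d ∧
      ∀ w, G.graph.Adj u w ↔ w = a ∨ w = b ∨ w = c ∨ w = d := by
  obtain ⟨a, t, hat, hs, ht⟩ := Set.eq_insert_of_ncard_eq_succ h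
  obtain ⟨b, c, d, hbc, hbd, hcd, rfl⟩ := Set.ncard_eq_three.1 ht
  refine ⟨a, b, c, d, ?_, ?_, ?_, hbc, hbd, hcd, fun w => by simpa using (Set.ext_iff.1 hs w).symm⟩
  all_goals
    rintro rfl
    simp at hat

end Neighbors

section Degrees

variable {V : Type*} [Fintype V] {G : WeightedGraph V}

/-- By connectedness an isolated vertex would be the whole graph, which then has no edge instead of
the required two. -/
theorem two_le_ncard_neighborSet (hG : G.IsBicyclic) (hp : ¬ G.HasPendant) (v : V) :
    2 ≤ (G.graph.neighborSet v).ncard := by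
  classical
  have h1 : (G.graph.neighborSet v).ncard ≠ 1 := fun h => hp ⟨v, h⟩
  have h0 : (G.graph.neighborSet v).ncard ≠ 0 := by
    rcases subsingleton_or_nontrivial V with hV | hV
    · have hE : G.graph.edgeSet = ∅ := by
        rw [SimpleGraph.edgeSet_eq_empty]
        exact Subsingleton.elim _ _
      have := hG.2
      rw [hE] at this
      simp at this
    · have := hG.1.preconnected.degree_pos_of_nontrivial v
      rw [← SimpleGraph.card_neighborSet_eq_degree] at this
      rw [← Nat.card_coe_set_eq, Nat.card_eq_fintype_card]
      omega
  omega

theorem sum_ncard_neighborSet (hG : G.IsBicyclic) :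
    ∑ v, (G.graph.neighborSet v).ncard = 2 * Fintype.card V + 2 := by
  classical
  have h := G.graph.sum_degrees_eq_twice_card_edges
  have hE := hG.2
  rw [Nat.card_eq_fintype_card, Nat.card_eq_fintype_card, ← SimpleGraph.edgeFinset_card] at hE
  rw [hE] at h
  rw [show 2 * Fintype.card V + 2 = 2 * (Fintype.card V + 1) by ring, ← h]
  refine Finset.sum_congr rfl fun v _ => ?_
  rw [← SimpleGraph.card_neighborSet_eq_degree, ← Nat.card_coe_set_eq, Nat.card_eq_fintype_card]

/-- The degrees of a bicyclic graph without pendants. -/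
theorem degrees_of_bicyclic (hG : G.IsBicyclic) (hp : ¬ G.HasPendant) :
    (∃ u, (G.graph.neighborSet u).ncard = 4 ∧
      ∀ x, x ≠ u → (G.graph.neighborSet x).ncard = 2) ∨
    (∃ u v, u ≠ v ∧ (G.graph.neighborSet u).ncard = 3 ∧ (G.graph.neighborSet v).ncard = 3 ∧
      ∀ x, x ≠ u → x ≠ v → (G.graph.neighborSet x).ncard = 2) := by
  classical
  have h2 := two_le_ncard_neighborSet hG hp
  -- The truncated subtraction is exact because all degrees are at least 2. An excess of total 2
  -- sits at one vertex or is split between two.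
  have hsum : ∑ v, ((G.graph.neighborSet v).ncard - 2) = 2 := by
    have h := sum_ncard_neighborSet hG
    have : ∑ v, (G.graph.neighborSet v).ncard =
        ∑ v, (((G.graph.neighborSet v).ncard - 2) + 2) :=
      Finset.sum_congr rfl fun v _ => by have := h2 v; omega
    rw [this, Finset.sum_add_distrib] at h
    simp at h
    omega
  obtain ⟨u, -, hu⟩ : ∃ u ∈ Finset.univ, (G.graph.neighborSet u).ncard - 2 ≠ 0 :=
    Finset.exists_ne_zero_of_sum_ne_zero (by omega)
  rw [← Finset.add_sum_erase _ _ (Finset.mem_univ u)] at hsum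
  by_cases h4 : (G.graph.neighborSet u).ncard = 4
  · refine Or.inl ⟨u, h4, fun x hx => ?_⟩
    have h0 : ∑ v ∈ Finset.univ.erase u, ((G.graph.neighborSet v).ncard - 2) = 0 := by omega
    have := Finset.sum_eq_zero_iff.1 h0 x (by simp [hx])
    have := h2 x
    omega
  · have h1 : ∑ v ∈ Finset.univ.erase u, ((G.graph.neighborSet v).ncard - 2) = 1 := by omega
    obtain ⟨v, hv, hv0⟩ := Finset.exists_ne_zero_of_sum_ne_zero (h1.trans_ne one_ne_zero)
    rw [← Finset.add_sum_erase _ _ hv] at h1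
    refine Or.inr ⟨u, v, (Finset.ne_of_mem_erase hv).symm, by omega, by omega, ?_⟩
    intro x hxu hxv
    have h0 : ∑ w ∈ (Finset.univ.erase u).erase v, ((G.graph.neighborSet w).ncard - 2) = 0 := by
      omega
    have := Finset.sum_eq_zero_iff.1 h0 x (by simp [hxu, hxv])
    have := h2 x
    omega

end Degrees

/-! ### Consequences of rank below 5 near a branch vertex -/

section Structure

variable {V : Type*} [Fintype V] {G : WeightedGraph V}

/-- A path `m₂ n₂ u n₁ m k` gives an induced cycle of length `5` or `6`, or an induced path. -/
theorem five_le_rank_of_path {u n₁ n₂ m k m₂ : V} (hu2 : G.graph.Adj u n₂)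
    (hne : n₂ ≠ n₁) (h12 : ¬ G.graph.Adj n₂ n₁)
    (hn1 : ∀ w, G.graph.Adj n₁ w ↔ w = u ∨ w = m)
    (hm : ∀ w, G.graph.Adj m w ↔ w = n₁ ∨ w = k) (hmu : ¬ G.graph.Adj m u)
    (hku : ¬ G.graph.Adj k u) (h22 : G.graph.Adj n₂ m₂) (hm2u : m₂ ≠ u)
    (hm2 : ¬ G.graph.Adj m₂ u) : 5 ≤ G.rank := by
  have hs : ∀ a b, G.graph.Adj a b → G.graph.Adj b a := fun _ _ h => h.symm
  have hi : ∀ a, ¬ G.graph.Adj a a := fun _ => G.graph.irrefl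
  have hun : G.graph.Adj n₁ u := by simp [hn1]
  have hnm : G.graph.Adj n₁ m := by simp [hn1]
  have hmk : G.graph.Adj m k := by simp [hm]
  by_cases h1 : G.graph.Adj n₂ k
  · apply five_le_rank_of_cycle_five (v₁ := u) (v₂ := n₁) (v₃ := m) (v₄ := k) (v₅ := n₂) <;> grind
  · by_cases h2 : G.graph.Adj m₂ k
    · have := six_le_rank_of_cycle_six (G := G) (v₁ := u) (v₂ := n₁) (v₃ := m) (v₄ := k)
        (v₅ := m₂) (v₆ := n₂) (by grind) (by grind) (by grind) (by grind) (by grind) (by grind)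
        (by grind) (by grind) (by grind) (by grind) (by grind) (by grind) (by grind) (by grind)
        (by grind)
      omega
    · have := six_le_rank_of_pendant_elimination (G := G) (p₁ := m₂) (p₂ := n₂) (p₃ := u)
        (p₄ := n₁) (p₅ := m) (p₆ := k) (by grind) (by grind) (by grind) (by grind) (by grind)
        (by grind) (by grind) (by grind) (by grind)
      omega

/-- The walk from `u` through `c` either closes at `d`, giving two triangles at `u`, or reaches a
vertex not adjacent to the triangle `u a b`. -/
theorem five_le_rank_of_triangle_four {u a b c d : V} (hab : a ≠ b) (hac : a ≠ c) (had : a ≠ d)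
    (hbc : b ≠ c) (hbd : b ≠ d) (hcd : c ≠ d)
    (hu : ∀ w, G.graph.Adj u w ↔ w = a ∨ w = b ∨ w = c ∨ w = d)
    (h2 : ∀ x, x ≠ u → (G.graph.neighborSet x).ncard = 2) (h : G.graph.Adj a b) :
    5 ≤ G.rank := by
  have hs : ∀ a b, G.graph.Adj a b → G.graph.Adj b a := fun _ _ h => h.symm
  have hi : ∀ a, ¬ G.graph.Adj a a := fun _ => G.graph.irrefl
  have ua : G.graph.Adj u a := by simp [hu]
  have ub : G.graph.Adj u b := by simp [hu]
  have uc : G.graph.Adj u c := by simp [hu]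
  have ud : G.graph.Adj u d := by simp [hu]
  obtain ⟨a', -, ka, ha⟩ := exists_neighbor_of_ncard_two (h2 a (by grind)) (n := u) (by grind)
  obtain ⟨b', -, kb, hb⟩ := exists_neighbor_of_ncard_two (h2 b (by grind)) (n := u) (by grind)
  obtain ⟨m, hmu, kc, hc⟩ := exists_neighbor_of_ncard_two (h2 c (by grind)) (n := u) (by grind)
  obtain ⟨d', -, kd, hd⟩ := exists_neighbor_of_ncard_two (h2 d (by grind)) (n := u) (by grind)
  have ha' : a' = b := by grind
  have hb' : b' = a := by grind
  subst ha' hb'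
  by_cases hm : m = d
  · subst hm
    apply five_le_rank_of_bowtie (u := u) (x₁ := b') (x₂ := a') (y₁ := c) (y₂ := m) <;> grind
  · apply five_le_rank_of_triangle_edge (t₁ := u) (t₂ := b') (t₃ := a') (z := c) (m := m) <;> grind

theorem five_le_rank_of_triangle_three {u a b c : V}
    (hu : ∀ w, G.graph.Adj u w ↔ w = a ∨ w = b ∨ w = c)
    (h2a : (G.graph.neighborSet a).ncard = 2) (h2b : (G.graph.neighborSet b).ncard = 2)
    (h : G.graph.Adj a b) {m : V} (hm : G.graph.Adj c m) (hma : m ≠ a) (hmb : m ≠ b)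
    (hmu : m ≠ u) : 5 ≤ G.rank := by
  have hs : ∀ a b, G.graph.Adj a b → G.graph.Adj b a := fun _ _ h => h.symm
  have hi : ∀ a, ¬ G.graph.Adj a a := fun _ => G.graph.irrefl
  have ua : G.graph.Adj u a := by simp [hu]
  have ub : G.graph.Adj u b := by simp [hu]
  have uc : G.graph.Adj u c := by simp [hu]
  obtain ⟨a', -, ka, ha⟩ := exists_neighbor_of_ncard_two h2a (n := u) (by grind)
  obtain ⟨b', -, kb, hb⟩ := exists_neighbor_of_ncard_two h2b (n := u) (by grind)
  apply five_le_rank_of_triangle_edge (t₁ := u) (t₂ := a) (t₃ := b) (z := c) (m := m) <;> grind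

/-- The second vertex after a neighbor `a` of the center lies on a cycle of length `4`. -/
theorem exists_four_cycle {u a b c d : V} (hab : a ≠ b) (hac : a ≠ c) (had : a ≠ d)
    (hbc : b ≠ c) (hbd : b ≠ d) (hcd : c ≠ d)
    (hu : ∀ w, G.graph.Adj u w ↔ w = a ∨ w = b ∨ w = c ∨ w = d)
    (h2 : ∀ x, x ≠ u → (G.graph.neighborSet x).ncard = 2) (hr : G.rank < 5) :
    ∃ m k, m ≠ u ∧ (∀ w, G.graph.Adj a w ↔ w = u ∨ w = m) ∧
      (∀ w, G.graph.Adj m w ↔ w = a ∨ w = k) ∧ (k = b ∨ k = c ∨ k = d) := by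
  have hs : ∀ a b, G.graph.Adj a b → G.graph.Adj b a := fun _ _ h => h.symm
  have hi : ∀ a, ¬ G.graph.Adj a a := fun _ => G.graph.irrefl
  have ua : G.graph.Adj u a := by simp [hu]
  have ub : G.graph.Adj u b := by simp [hu]
  have uc : G.graph.Adj u c := by simp [hu]
  have ud : G.graph.Adj u d := by simp [hu]
  have tab : ¬ G.graph.Adj a b := fun h => hr.not_ge <|
    five_le_rank_of_triangle_four hab hac had hbc hbd hcd hu h2 h
  have tac : ¬ G.graph.Adj a c := fun h => hr.not_ge <|
    five_le_rank_of_triangle_four hac hab had hbc.symm hcd hbd (by grind) h2 h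
  have tad : ¬ G.graph.Adj a d := fun h => hr.not_ge <|
    five_le_rank_of_triangle_four had hab hac hbd.symm hcd.symm hbc (by grind) h2 h
  have tbc : ¬ G.graph.Adj b c := fun h => hr.not_ge <|
    five_le_rank_of_triangle_four hbc hab.symm hbd hac.symm hcd had (by grind) h2 h
  have tbd : ¬ G.graph.Adj b d := fun h => hr.not_ge <|
    five_le_rank_of_triangle_four hbd hab.symm hbc had.symm hcd.symm hac (by grind) h2 h
  obtain ⟨m, hmu, ka, ha⟩ := exists_neighbor_of_ncard_two (h2 a (by grind)) (n := u) (by grind)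
  obtain ⟨k, hka, km, hm⟩ := exists_neighbor_of_ncard_two (h2 m hmu) (n := a) (by grind)
  obtain ⟨m', hmu', kb, hb⟩ := exists_neighbor_of_ncard_two (h2 b (by grind)) (n := u) (by grind)
  refine ⟨m, k, hmu, ha, hm, ?_⟩
  -- Otherwise `k` is not adjacent to `u`, and leaving `u` along `b` as well gives the configuration
  -- of `five_le_rank_of_path`; the excluded triangles keep `m'` away from `u`.
  by_contra hk
  exact hr.not_ge (five_le_rank_of_path (u := u) (n₁ := a) (n₂ := b) (m := m) (k := k)
    (m₂ := m') (by grind) hab.symm (by grind) ha hm (by grind) (by grind) (by grind) hmu'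
    (by grind))

end Structure

end WeightedGraph

namespace WeightedGraph

/-! ### Recognizing the five shapes from their neighbourhoods -/

section Assembly

variable {V : Type*} {G : WeightedGraph V}

theorem exists_isIsomorphic_theta (hG : G.graph.Connected) {p l q : ℕ}
    (he : Function.Injective (thetaEdge p l q)) {g : ThetaVertex p l q → V}
    (hg : Function.Injective g) (h1 : ∀ i, (thetaEdge p l q i).map g ∈ G.graph.edgeSet)
    (h2 : ∀ s w, G.graph.Adj (g s) w → ∃ t i, g t = w ∧ thetaEdge p l q i = s(s, t)) :
    ∃ a b c, G.IsIsomorphic (theta p l q a b c) := by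
  have : Nonempty (ThetaVertex p l q) := ⟨.u⟩
  obtain ⟨w, hw⟩ := exists_isIsomorphic_ofEdges hG he hg h1 h2
  refine ⟨w ∘ .inl, w ∘ .inr ∘ .inl, w ∘ .inr ∘ .inr, ?_⟩
  rw [theta]
  convert hw
  ext (i | i | i) <;> rfl

theorem exists_isIsomorphic_theta_one_one_one (hG : G.graph.Connected) {u v x y z : V}
    (huv : u ≠ v) (hxy : x ≠ y) (hxz : x ≠ z) (hyz : y ≠ z)
    (hu : ∀ w, G.graph.Adj u w ↔ w = x ∨ w = y ∨ w = z)
    (hv : ∀ w, G.graph.Adj v w ↔ w = x ∨ w = y ∨ w = z)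
    (hx : ∀ w, G.graph.Adj x w ↔ w = u ∨ w = v) (hy : ∀ w, G.graph.Adj y w ↔ w = u ∨ w = v)
    (hz : ∀ w, G.graph.Adj z w ↔ w = u ∨ w = v) :
    ∃ a b c, G.IsIsomorphic (theta 1 1 1 a b c) := by
  have hi : ∀ a b, G.graph.Adj a b → a ≠ b := fun _ _ h => h.ne
  have ux := hi u x (by simp [hu])
  have uy := hi u y (by simp [hu])
  have uz := hi u z (by simp [hu])
  have vx := hi v x (by simp [hv])
  have vy := hi v y (by simp [hv])
  have vz := hi v z (by simp [hv])
  let g : ThetaVertex 1 1 1 → V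
    | .u => u
    | .v => v
    | .x _ => x
    | .y _ => y
    | .z _ => z
  refine exists_isIsomorphic_theta hG (g := g) ?_ ?_ ?_ ?_
  · rintro (i | i | i) (j | j | j) <;> fin_cases i <;> fin_cases j <;>
      simp [thetaEdge, walkVertex]
  · rintro (_ | _ | i | i | i) (_ | _ | j | j | j) <;> (try fin_cases i) <;>
      (try fin_cases j) <;> simp [g] <;> grind
  · rintro (i | i | i) <;> fin_cases i <;> simp [thetaEdge, walkVertex, g, hu, hx, hy, hz]
  · rintro (_ | _ | i | i | i) w h
    · rcases (hu w).1 h with rfl | rfl | rfl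
      · exact ⟨.x 0, .inl 0, rfl, by simp [thetaEdge, walkVertex]⟩
      · exact ⟨.y 0, .inr (.inl 0), rfl, by simp [thetaEdge, walkVertex]⟩
      · exact ⟨.z 0, .inr (.inr 0), rfl, by simp [thetaEdge, walkVertex]⟩
    · rcases (hv w).1 h with rfl | rfl | rfl
      · exact ⟨.x 0, .inl 1, rfl, by simp [thetaEdge, walkVertex]⟩
      · exact ⟨.y 0, .inr (.inl 1), rfl, by simp [thetaEdge, walkVertex]⟩
      · exact ⟨.z 0, .inr (.inr 1), rfl, by simp [thetaEdge, walkVertex]⟩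
    · fin_cases i
      rcases (hx w).1 h with rfl | rfl
      · exact ⟨.u, .inl 0, rfl, by simp [thetaEdge, walkVertex]⟩
      · exact ⟨.v, .inl 1, rfl, by simp [thetaEdge, walkVertex]⟩
    · fin_cases i
      rcases (hy w).1 h with rfl | rfl
      · exact ⟨.u, .inr (.inl 0), rfl, by simp [thetaEdge, walkVertex]⟩
      · exact ⟨.v, .inr (.inl 1), rfl, by simp [thetaEdge, walkVertex]⟩
    · fin_cases i
      rcases (hz w).1 h with rfl | rfl
      · exact ⟨.u, .inr (.inr 0), rfl, by simp [thetaEdge, walkVertex]⟩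
      · exact ⟨.v, .inr (.inr 1), rfl, by simp [thetaEdge, walkVertex]⟩

theorem exists_isIsomorphic_theta_one_zero_one (hG : G.graph.Connected) {u v x z : V}
    (hxz : x ≠ z)
    (hu : ∀ w, G.graph.Adj u w ↔ w = v ∨ w = x ∨ w = z)
    (hv : ∀ w, G.graph.Adj v w ↔ w = u ∨ w = x ∨ w = z)
    (hx : ∀ w, G.graph.Adj x w ↔ w = u ∨ w = v)
    (hz : ∀ w, G.graph.Adj z w ↔ w = u ∨ w = v) :
    ∃ a b c, G.IsIsomorphic (theta 1 0 1 a b c) := by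
  have hi : ∀ a b, G.graph.Adj a b → a ≠ b := fun _ _ h => h.ne
  have uv := hi u v (by simp [hu])
  have ux := hi u x (by simp [hu])
  have uz := hi u z (by simp [hu])
  have vx := hi v x (by simp [hv])
  have vz := hi v z (by simp [hv])
  let g : ThetaVertex 1 0 1 → V
    | .u => u
    | .v => v
    | .x _ => x
    -- A dummy value: the middle path has no internal vertex.
    | .y _ => u
    | .z _ => z
  refine exists_isIsomorphic_theta hG (g := g) ?_ ?_ ?_ ?_
  · rintro (i | i | i) (j | j | j) <;> fin_cases i <;> fin_cases j <;>
      simp [thetaEdge, walkVertex]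
  · rintro (_ | _ | i | i | i) (_ | _ | j | j | j) <;> (try fin_cases i) <;>
      (try fin_cases j) <;> simp [g] <;> grind
  · rintro (i | i | i) <;> fin_cases i <;> simp [thetaEdge, walkVertex, g, hu, hx, hz]
  · rintro (_ | _ | i | i | i) w h
    · rcases (hu w).1 h with rfl | rfl | rfl
      · exact ⟨.v, .inr (.inl 0), rfl, by simp [thetaEdge, walkVertex]⟩
      · exact ⟨.x 0, .inl 0, rfl, by simp [thetaEdge, walkVertex]⟩
      · exact ⟨.z 0, .inr (.inr 0), rfl, by simp [thetaEdge, walkVertex]⟩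
    · rcases (hv w).1 h with rfl | rfl | rfl
      · exact ⟨.u, .inr (.inl 0), rfl, by simp [thetaEdge, walkVertex]⟩
      · exact ⟨.x 0, .inl 1, rfl, by simp [thetaEdge, walkVertex]⟩
      · exact ⟨.z 0, .inr (.inr 1), rfl, by simp [thetaEdge, walkVertex]⟩
    · fin_cases i
      rcases (hx w).1 h with rfl | rfl
      · exact ⟨.u, .inl 0, rfl, by simp [thetaEdge, walkVertex]⟩
      · exact ⟨.v, .inl 1, rfl, by simp [thetaEdge, walkVertex]⟩
    · exact i.elim0
    · fin_cases i
      rcases (hz w).1 h with rfl | rfl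
      · exact ⟨.u, .inr (.inr 0), rfl, by simp [thetaEdge, walkVertex]⟩
      · exact ⟨.v, .inr (.inr 1), rfl, by simp [thetaEdge, walkVertex]⟩

theorem exists_isIsomorphic_theta_one_zero_two (hG : G.graph.Connected) {u v x z₁ z₂ : V}
    (hx1 : x ≠ z₁) (hx2 : x ≠ z₂)
    (hu : ∀ w, G.graph.Adj u w ↔ w = v ∨ w = x ∨ w = z₁)
    (hv : ∀ w, G.graph.Adj v w ↔ w = u ∨ w = x ∨ w = z₂)
    (hx : ∀ w, G.graph.Adj x w ↔ w = u ∨ w = v)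
    (hz1 : ∀ w, G.graph.Adj z₁ w ↔ w = u ∨ w = z₂)
    (hz2 : ∀ w, G.graph.Adj z₂ w ↔ w = v ∨ w = z₁) :
    ∃ a b c, G.IsIsomorphic (theta 1 0 2 a b c) := by
  have hi : ∀ a b, G.graph.Adj a b → a ≠ b := fun _ _ h => h.ne
  have uv := hi u v (by simp [hu])
  have ux := hi u x (by simp [hu])
  have uz := hi u z₁ (by simp [hu])
  have vx := hi v x (by simp [hv])
  have vz := hi v z₂ (by simp [hv])
  have zz := hi z₁ z₂ (by simp [hz1])
  -- If `u` were `z₂`, its neighbour `x` would have to be `v` or `z₁`.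
  have uz2 : u ≠ z₂ := by rintro rfl; have := (hz2 x).1 (by simp [hu]); grind
  have vz1 : v ≠ z₁ := by rintro rfl; have := (hz1 x).1 (by simp [hv]); grind
  let g : ThetaVertex 1 0 2 → V
    | .u => u
    | .v => v
    | .x _ => x
    | .y _ => u
    | .z i => ![z₁, z₂] i
  refine exists_isIsomorphic_theta hG (g := g) ?_ ?_ ?_ ?_
  · rintro (i | i | i) (j | j | j) <;> fin_cases i <;> fin_cases j <;>
      simp [thetaEdge, walkVertex]
  · rintro (_ | _ | i | i | i) (_ | _ | j | j | j) <;> (try fin_cases i) <;>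
      (try fin_cases j) <;> simp [g] <;> grind
  · rintro (i | i | i) <;> fin_cases i <;>
      simp [thetaEdge, walkVertex, g, hu, hx, hz1, hz2]
  · rintro (_ | _ | i | i | i) w h
    · rcases (hu w).1 h with rfl | rfl | rfl
      · exact ⟨.v, .inr (.inl 0), rfl, by simp [thetaEdge, walkVertex]⟩
      · exact ⟨.x 0, .inl 0, rfl, by simp [thetaEdge, walkVertex]⟩
      · exact ⟨.z 0, .inr (.inr 0), rfl, by simp [thetaEdge, walkVertex]⟩
    · rcases (hv w).1 h with rfl | rfl | rfl
      · exact ⟨.u, .inr (.inl 0), rfl, by simp [thetaEdge, walkVertex]⟩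
      · exact ⟨.x 0, .inl 1, rfl, by simp [thetaEdge, walkVertex]⟩
      · exact ⟨.z 1, .inr (.inr 2), rfl, by simp [thetaEdge, walkVertex]⟩
    · fin_cases i
      rcases (hx w).1 h with rfl | rfl
      · exact ⟨.u, .inl 0, rfl, by simp [thetaEdge, walkVertex]⟩
      · exact ⟨.v, .inl 1, rfl, by simp [thetaEdge, walkVertex]⟩
    · exact i.elim0
    · fin_cases i
      · rcases (hz1 w).1 h with rfl | rfl
        · exact ⟨.u, .inr (.inr 0), rfl, by simp [thetaEdge, walkVertex]⟩
        · exact ⟨.z 1, .inr (.inr 1), rfl, by simp [thetaEdge, walkVertex]⟩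
      · rcases (hz2 w).1 h with rfl | rfl
        · exact ⟨.v, .inr (.inr 2), rfl, by simp [thetaEdge, walkVertex]⟩
        · exact ⟨.z 0, .inr (.inr 1), rfl, by simp [thetaEdge, walkVertex]⟩

theorem exists_isIsomorphic_theta_two_zero_two (hG : G.graph.Connected) {u v x₁ x₂ z₁ z₂ : V}
    (h11 : x₁ ≠ z₁) (h22 : x₂ ≠ z₂) (h12 : x₁ ≠ z₂) (h21 : x₂ ≠ z₁)
    (ux2 : u ≠ x₂) (uz2 : u ≠ z₂) (vx1 : v ≠ x₁) (vz1 : v ≠ z₁)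
    (hu : ∀ w, G.graph.Adj u w ↔ w = v ∨ w = x₁ ∨ w = z₁)
    (hv : ∀ w, G.graph.Adj v w ↔ w = u ∨ w = x₂ ∨ w = z₂)
    (hx1 : ∀ w, G.graph.Adj x₁ w ↔ w = u ∨ w = x₂)
    (hx2 : ∀ w, G.graph.Adj x₂ w ↔ w = v ∨ w = x₁)
    (hz1 : ∀ w, G.graph.Adj z₁ w ↔ w = u ∨ w = z₂)
    (hz2 : ∀ w, G.graph.Adj z₂ w ↔ w = v ∨ w = z₁) :
    ∃ a b c, G.IsIsomorphic (theta 2 0 2 a b c) := by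
  have hi : ∀ a b, G.graph.Adj a b → a ≠ b := fun _ _ h => h.ne
  have uv := hi u v (by simp [hu])
  have ux := hi u x₁ (by simp [hu])
  have uz := hi u z₁ (by simp [hu])
  have vx := hi v x₂ (by simp [hv])
  have vz := hi v z₂ (by simp [hv])
  have xx := hi x₁ x₂ (by simp [hx1])
  have zz := hi z₁ z₂ (by simp [hz1])
  let g : ThetaVertex 2 0 2 → V
    | .u => u
    | .v => v
    | .x i => ![x₁, x₂] i
    | .y _ => u
    | .z i => ![z₁, z₂] i
  refine exists_isIsomorphic_theta hG (g := g) ?_ ?_ ?_ ?_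
  · rintro (i | i | i) (j | j | j) <;> fin_cases i <;> fin_cases j <;>
      simp [thetaEdge, walkVertex]
  · rintro (_ | _ | i | i | i) (_ | _ | j | j | j) <;> (try fin_cases i) <;>
      (try fin_cases j) <;> simp [g] <;> grind
  · rintro (i | i | i) <;> fin_cases i <;>
      simp [thetaEdge, walkVertex, g, hu, hx1, hx2, hz1, hz2]
  · rintro (_ | _ | i | i | i) w h
    · rcases (hu w).1 h with rfl | rfl | rfl
      · exact ⟨.v, .inr (.inl 0), rfl, by simp [thetaEdge, walkVertex]⟩
      · exact ⟨.x 0, .inl 0, rfl, by simp [thetaEdge, walkVertex]⟩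
      · exact ⟨.z 0, .inr (.inr 0), rfl, by simp [thetaEdge, walkVertex]⟩
    · rcases (hv w).1 h with rfl | rfl | rfl
      · exact ⟨.u, .inr (.inl 0), rfl, by simp [thetaEdge, walkVertex]⟩
      · exact ⟨.x 1, .inl 2, rfl, by simp [thetaEdge, walkVertex]⟩
      · exact ⟨.z 1, .inr (.inr 2), rfl, by simp [thetaEdge, walkVertex]⟩
    · fin_cases i
      · rcases (hx1 w).1 h with rfl | rfl
        · exact ⟨.u, .inl 0, rfl, by simp [thetaEdge, walkVertex]⟩
        · exact ⟨.x 1, .inl 1, rfl, by simp [thetaEdge, walkVertex]⟩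
      · rcases (hx2 w).1 h with rfl | rfl
        · exact ⟨.v, .inl 2, rfl, by simp [thetaEdge, walkVertex]⟩
        · exact ⟨.x 0, .inl 1, rfl, by simp [thetaEdge, walkVertex]⟩
    · exact i.elim0
    · fin_cases i
      · rcases (hz1 w).1 h with rfl | rfl
        · exact ⟨.u, .inr (.inr 0), rfl, by simp [thetaEdge, walkVertex]⟩
        · exact ⟨.z 1, .inr (.inr 1), rfl, by simp [thetaEdge, walkVertex]⟩
      · rcases (hz2 w).1 h with rfl | rfl
        · exact ⟨.v, .inr (.inr 2), rfl, by simp [thetaEdge, walkVertex]⟩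
        · exact ⟨.z 0, .inr (.inr 1), rfl, by simp [thetaEdge, walkVertex]⟩

theorem exists_isIsomorphic_infty_four_one_four (hG : G.graph.Connected)
    {u x₀ x₁ x₂ y₀ y₁ y₂ : V} (hxx : x₀ ≠ x₂) (hyy : y₀ ≠ y₂) (h00 : x₀ ≠ y₀) (h02 : x₀ ≠ y₂)
    (h20 : x₂ ≠ y₀) (h22 : x₂ ≠ y₂) (hux1 : x₁ ≠ u) (huy1 : y₁ ≠ u)
    (hu : ∀ w, G.graph.Adj u w ↔ w = x₀ ∨ w = x₂ ∨ w = y₀ ∨ w = y₂)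
    (hx0 : ∀ w, G.graph.Adj x₀ w ↔ w = u ∨ w = x₁)
    (hx1 : ∀ w, G.graph.Adj x₁ w ↔ w = x₀ ∨ w = x₂)
    (hx2 : ∀ w, G.graph.Adj x₂ w ↔ w = u ∨ w = x₁)
    (hy0 : ∀ w, G.graph.Adj y₀ w ↔ w = u ∨ w = y₁)
    (hy1 : ∀ w, G.graph.Adj y₁ w ↔ w = y₀ ∨ w = y₂)
    (hy2 : ∀ w, G.graph.Adj y₂ w ↔ w = u ∨ w = y₁) :
    ∃ (a b : Fin 4 → {x : ℝ // 0 < x}) (c : Fin 0 → {x : ℝ // 0 < x}),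
      G.IsIsomorphic (infty 4 1 4 a b c) := by
  have hi : ∀ a b, G.graph.Adj a b → a ≠ b := fun _ _ h => h.ne
  have u0 := hi u x₀ (by simp [hu])
  have u2 := hi u x₂ (by simp [hu])
  have v0 := hi u y₀ (by simp [hu])
  have v2 := hi u y₂ (by simp [hu])
  have x01 := hi x₀ x₁ (by simp [hx0])
  have x21 := hi x₂ x₁ (by simp [hx2])
  have y01 := hi y₀ y₁ (by simp [hy0])
  have y21 := hi y₂ y₁ (by simp [hy2])
  have a1 : x₁ ≠ y₁ := by rintro rfl; have := (hx1 y₀).1 (by simp [hy1]); grind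
  have a2 : x₁ ≠ y₀ := by rintro rfl; have := (hx1 u).1 (by simp [hy0]); grind
  have a3 : x₁ ≠ y₂ := by rintro rfl; have := (hx1 u).1 (by simp [hy2]); grind
  have a4 : y₁ ≠ x₀ := by rintro rfl; have := (hy1 u).1 (by simp [hx0]); grind
  have a5 : y₁ ≠ x₂ := by rintro rfl; have := (hy1 u).1 (by simp [hx2]); grind
  let g : InftyVertex 4 1 4 → V
    | .path _ => u
    | .x i => ![x₀, x₁, x₂] i
    | .y i => ![y₀, y₁, y₂] i
  have : Nonempty (InftyVertex 4 1 4) := ⟨.path 0⟩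
  suffices ∃ w, G.IsIsomorphic (ofEdges (inftyEdge 4 1 4) w) by
    obtain ⟨w, hw⟩ := this
    refine ⟨w ∘ .inl, w ∘ .inr ∘ .inl, w ∘ .inr ∘ .inr, ?_⟩
    rw [infty]
    convert hw
    ext (i | i | i) <;> rfl
  refine exists_isIsomorphic_ofEdges hG (g := g) ?_ ?_ ?_ ?_
  · rintro (i | i | i) (j | j | j) <;> fin_cases i <;> fin_cases j <;>
      simp [inftyEdge, walkVertex, inftyFirst, inftyLast]
  · rintro (i | i | i) (j | j | j) <;> fin_cases i <;> fin_cases j <;> simp [g] <;> grind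
  · rintro (i | i | i) <;> fin_cases i <;>
      simp [inftyEdge, walkVertex, inftyFirst, inftyLast, g, hu, hx0, hx1, hx2, hy0, hy1, hy2]
  · rintro (i | i | i) w h <;> fin_cases i
    · rcases (hu w).1 h with rfl | rfl | rfl | rfl
      · exact ⟨.x 0, .inl 0, rfl, by simp [inftyEdge, walkVertex, inftyFirst]⟩
      · exact ⟨.x 2, .inl 3, rfl, by simp [inftyEdge, walkVertex, inftyFirst]⟩
      · exact ⟨.y 0, .inr (.inl 0), rfl, by simp [inftyEdge, walkVertex, inftyLast]⟩
      · exact ⟨.y 2, .inr (.inl 3), rfl, by simp [inftyEdge, walkVertex, inftyLast]⟩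
    · rcases (hx0 w).1 h with rfl | rfl
      · exact ⟨.path 0, .inl 0, rfl, by simp [inftyEdge, walkVertex, inftyFirst]⟩
      · exact ⟨.x 1, .inl 1, rfl, by simp [inftyEdge, walkVertex]⟩
    · rcases (hx1 w).1 h with rfl | rfl
      · exact ⟨.x 0, .inl 1, rfl, by simp [inftyEdge, walkVertex]⟩
      · exact ⟨.x 2, .inl 2, rfl, by simp [inftyEdge, walkVertex]⟩
    · rcases (hx2 w).1 h with rfl | rfl
      · exact ⟨.path 0, .inl 3, rfl, by simp [inftyEdge, walkVertex, inftyFirst]⟩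
      · exact ⟨.x 1, .inl 2, rfl, by simp [inftyEdge, walkVertex]⟩
    · rcases (hy0 w).1 h with rfl | rfl
      · exact ⟨.path 0, .inr (.inl 0), rfl, by simp [inftyEdge, walkVertex, inftyLast]⟩
      · exact ⟨.y 1, .inr (.inl 1), rfl, by simp [inftyEdge, walkVertex]⟩
    · rcases (hy1 w).1 h with rfl | rfl
      · exact ⟨.y 0, .inr (.inl 1), rfl, by simp [inftyEdge, walkVertex]⟩
      · exact ⟨.y 2, .inr (.inl 2), rfl, by simp [inftyEdge, walkVertex]⟩
    · rcases (hy2 w).1 h with rfl | rfl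
      · exact ⟨.path 0, .inr (.inl 3), rfl, by simp [inftyEdge, walkVertex, inftyLast]⟩
      · exact ⟨.y 1, .inr (.inl 2), rfl, by simp [inftyEdge, walkVertex]⟩

end Assembly

end WeightedGraph

namespace WeightedGraph

/-! ### Classification of the shapes of rank below 5 -/

section Classification

variable {V : Type*} [Fintype V] {G : WeightedGraph V}

theorem exists_infty_of_ncard_four (hG : G.graph.Connected) (hr : G.rank < 5) {u : V}
    (h4 : (G.graph.neighborSet u).ncard = 4)
    (h2 : ∀ x, x ≠ u → (G.graph.neighborSet x).ncard = 2) :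
    ∃ (a b : Fin 4 → {x : ℝ // 0 < x}) (c : Fin 0 → {x : ℝ // 0 < x}),
      G.IsIsomorphic (infty 4 1 4 a b c) := by
  have hs : ∀ a b, G.graph.Adj a b → G.graph.Adj b a := fun _ _ h => h.symm
  have hi : ∀ a, ¬ G.graph.Adj a a := fun _ => G.graph.irrefl
  -- Up to relabelling, the 4-cycle through `a` returns to the centre at `b`; it remains to find the
  -- second cycle through `c` and `d`.
  have key : ∀ a b c d, a ≠ b → a ≠ c → a ≠ d → b ≠ c → b ≠ d → c ≠ d →
      (∀ w, G.graph.Adj u w ↔ w = a ∨ w = b ∨ w = c ∨ w = d) →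
      ∀ m, m ≠ u → (∀ w, G.graph.Adj a w ↔ w = u ∨ w = m) →
      (∀ w, G.graph.Adj m w ↔ w = a ∨ w = b) →
      ∃ (a b : Fin 4 → {x : ℝ // 0 < x}) (c : Fin 0 → {x : ℝ // 0 < x}),
        G.IsIsomorphic (infty 4 1 4 a b c) := by
    intro a b c d hab hac had hbc hbd hcd hu m hmu ha hm
    have ub : G.graph.Adj u b := by simp [hu]
    have uc : G.graph.Adj u c := by simp [hu]
    have ud : G.graph.Adj u d := by simp [hu]
    have mb : G.graph.Adj m b := by simp [hm]
    obtain ⟨b', hb'u, kb, hb⟩ := exists_neighbor_of_ncard_two (h2 b (by grind)) ub.symm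
    have hb' : b' = m := by grind
    subst hb'
    obtain ⟨m', k, hm'u, hc, hm', hk⟩ := exists_four_cycle (a := c) (b := a) (c := b) (d := d)
      (by grind) (by grind) (by grind) (by grind) (by grind) (by grind) (by grind) h2 hr
    have cm' : G.graph.Adj c m' := by simp [hc]
    have mk' : G.graph.Adj m' k := by simp [hm']
    -- The vertices `a` and `b` already have both neighbours on the first cycle, so the walk from
    -- `c` can only return through `d`.
    obtain rfl : k = d := by
      rcases hk with rfl | rfl | rfl
      · have := (ha m').1 mk'.symm
        grind
      · have := (hb m').1 mk'.symm
        grind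
      · rfl
    obtain ⟨d', hd'u, kd, hd⟩ := exists_neighbor_of_ncard_two (h2 k (by grind)) ud.symm
    have hd' : d' = m' := by grind
    subst hd'
    exact exists_isIsomorphic_infty_four_one_four hG hab hcd hac had hbc hbd hmu hm'u hu ha hm hb
      hc hm' hd
  obtain ⟨a, b, c, d, hab, hac, had, hbc, hbd, hcd, hu⟩ := exists_neighbors_of_ncard_four h4
  obtain ⟨m, k, hmu, ha, hm, rfl | rfl | rfl⟩ :=
    exists_four_cycle hab hac had hbc hbd hcd hu h2 hr
  · exact key a k c d hab hac had hbc hbd hcd hu m hmu ha hm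
  · exact key a k b d hac hab had hbc.symm hcd hbd (by grind) m hmu ha hm
  · exact key a k b c had hab hac hbd.symm hcd.symm hbc (by grind) m hmu ha hm

/-- The case of two adjacent vertices of degree `3` with a common neighbor. -/
theorem exists_theta_of_common_neighbor (hG : G.graph.Connected) (hr : G.rank < 5) {u v x z z' : V}
    (hvx : v ≠ x) (hvz : v ≠ z) (hxz : x ≠ z) (hux : u ≠ x) (huz' : u ≠ z') (hxz' : x ≠ z')
    (hu : ∀ w, G.graph.Adj u w ↔ w = v ∨ w = x ∨ w = z)
    (hv : ∀ w, G.graph.Adj v w ↔ w = u ∨ w = x ∨ w = z')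
    (h2 : ∀ x, x ≠ u → x ≠ v → (G.graph.neighborSet x).ncard = 2) :
    (∃ a b c, G.IsIsomorphic (theta 1 0 1 a b c)) ∨
      ∃ a b c, G.IsIsomorphic (theta 1 0 2 a b c) := by
  have hs : ∀ a b, G.graph.Adj a b → G.graph.Adj b a := fun _ _ h => h.symm
  have hi : ∀ a, ¬ G.graph.Adj a a := fun _ => G.graph.irrefl
  have uv : G.graph.Adj u v := by simp [hu]
  have ux : G.graph.Adj u x := by simp [hu]
  have uz : G.graph.Adj u z := by simp [hu]
  have vx : G.graph.Adj v x := by simp [hv]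
  have vz' : G.graph.Adj v z' := by simp [hv]
  obtain ⟨x', hx', -, hx⟩ := exists_neighbor_of_ncard_two (h2 x hux.symm hvx.symm) ux.symm
  obtain rfl : x' = v := by grind
  obtain ⟨m, hmu, zm, hz⟩ := exists_neighbor_of_ncard_two (h2 z (by grind) hvz.symm) uz.symm
  obtain ⟨m', hmv', zm', hz'⟩ :=
    exists_neighbor_of_ncard_two (h2 z' huz'.symm (by grind)) vz'.symm
  by_cases hzz : z = z'
  · subst hzz
    obtain rfl : m = x' := by grind
    exact Or.inl (exists_isIsomorphic_theta_one_zero_one hG hxz hu hv hx hz)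
  · by_cases hadj : G.graph.Adj z z'
    · obtain rfl : m = z' := by grind
      obtain rfl : m' = z := by grind
      exact Or.inr (exists_isIsomorphic_theta_one_zero_two hG hxz hxz' hu hv hx hz hz')
    -- Only `z` and `z'` are attached to the triangle from outside, and `m` is neither, so the edge
    -- `z m` leads away from it.
    · refine absurd (five_le_rank_of_triangle_edge (t₁ := u) (t₂ := x') (t₃ := x) (z := z) (m := m)
        uv ux vx zm ?_ ?_ ?_) hr.not_ge <;> grind

/-- The case of two adjacent vertices of degree `3` without common neighbors. Each further
neighbor of one is adjacent to a further neighbor of the other. -/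
theorem exists_adj_of_no_common_neighbor (hr : G.rank < 5) {u v x z x' z' : V}
    (hvx : v ≠ x) (hvz : v ≠ z) (hux' : u ≠ x') (huz' : u ≠ z') (hxz' : x' ≠ z')
    (h11 : x ≠ x') (h12 : x ≠ z') (h21 : z ≠ x') (h22 : z ≠ z')
    (hu : ∀ w, G.graph.Adj u w ↔ w = v ∨ w = x ∨ w = z)
    (hv : ∀ w, G.graph.Adj v w ↔ w = u ∨ w = x' ∨ w = z')
    (h2 : ∀ x, x ≠ u → x ≠ v → (G.graph.neighborSet x).ncard = 2) :
    G.graph.Adj x x' ∨ G.graph.Adj x z' := by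
  have hs : ∀ a b, G.graph.Adj a b → G.graph.Adj b a := fun _ _ h => h.symm
  have hi : ∀ a, ¬ G.graph.Adj a a := fun _ => G.graph.irrefl
  by_contra! hcon
  obtain ⟨n1, n2⟩ := hcon
  have uv : G.graph.Adj u v := by simp [hu]
  have ux : G.graph.Adj u x := by simp [hu]
  have uz : G.graph.Adj u z := by simp [hu]
  have vx' : G.graph.Adj v x' := by simp [hv]
  have vz' : G.graph.Adj v z' := by simp [hv]
  have t1 : ¬ G.graph.Adj x z := fun h => hr.not_ge <|
    five_le_rank_of_triangle_three (u := u) (a := x) (b := z) (c := v) (by grind)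
      (h2 x (by grind) (by grind)) (h2 z (by grind) (by grind)) h vx' h11.symm h21.symm hux'.symm
  have t2 : ¬ G.graph.Adj x' z' := fun h => hr.not_ge <|
    five_le_rank_of_triangle_three (u := v) (a := x') (b := z') (c := u) (by grind)
      (h2 x' (by grind) (by grind)) (h2 z' (by grind) (by grind)) h ux h11 h12 hvx.symm
  -- Extend the path `x u v y` to `m` and `m'` at its ends. Then `m = m'` gives a 5-cycle, `m`
  -- adjacent to `m'` a 6-cycle, and otherwise a path on six vertices remains.
  have main : ∀ y, G.graph.Adj v y → y ≠ u → ¬ G.graph.Adj x y → ¬ G.graph.Adj z y →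
      y ≠ x → y ≠ z → y = x' ∨ y = z' → False := by
    intro y vy hyu hxy hzy hyx hyz hy
    obtain ⟨m, hmu, xm, hx⟩ := exists_neighbor_of_ncard_two (h2 x (by grind) hvx.symm) ux.symm
    obtain ⟨m', hmv', ym', hy'⟩ :=
      exists_neighbor_of_ncard_two (h2 y hyu (by grind)) vy.symm
    have hmv : m ≠ v := by grind
    have hm'u : m' ≠ u := by grind
    by_cases h1 : m = m'
    · subst h1
      refine hr.not_ge (five_le_rank_of_cycle_five (v₁ := m) (v₂ := x) (v₃ := u) (v₄ := v)
        (v₅ := y) ?_ ?_ ?_ ?_ ?_ ?_ ?_ ?_ ?_ ?_) <;> grind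
    · by_cases h3 : G.graph.Adj m m'
      · have := six_le_rank_of_cycle_six (G := G) (v₁ := x) (v₂ := u) (v₃ := v) (v₄ := y)
          (v₅ := m') (v₆ := m) (by grind) (by grind) (by grind) (by grind) (by grind) (by grind)
          (by grind) (by grind) (by grind) (by grind) (by grind) (by grind) (by grind) (by grind)
          (by grind)
        omega
      · have := six_le_rank_of_pendant_elimination (G := G) (p₁ := m) (p₂ := x) (p₃ := m')
          (p₄ := y) (p₅ := u) (p₆ := v) (by grind) (by grind) (by grind) (by grind) (by grind)
          (by grind) (by grind) (by grind) (by grind)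
        omega
  -- The vertex `y` must miss `z` too. If `z` is joined to `x'`, its two neighbours are `u` and
  -- `x'`, so `z'` serves; otherwise `x'` does.
  by_cases hz : G.graph.Adj z x'
  · obtain ⟨k, -, zk, hz'⟩ := exists_neighbor_of_ncard_two (h2 z (by grind) hvz.symm) uz.symm
    refine main z' vz' huz'.symm n2 ?_ h12.symm h22.symm (Or.inr rfl)
    grind
  · exact main x' vx' hux'.symm n1 hz h11.symm h21.symm (Or.inl rfl)

theorem exists_theta_of_no_common_neighbor (hG : G.graph.Connected) (hr : G.rank < 5)
    {u v x z x' z' : V} (hvx : v ≠ x) (hvz : v ≠ z) (hxz : x ≠ z) (hux' : u ≠ x') (huz' : u ≠ z')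
    (hxz' : x' ≠ z') (h11 : x ≠ x') (h12 : x ≠ z') (h21 : z ≠ x') (h22 : z ≠ z')
    (hu : ∀ w, G.graph.Adj u w ↔ w = v ∨ w = x ∨ w = z)
    (hv : ∀ w, G.graph.Adj v w ↔ w = u ∨ w = x' ∨ w = z')
    (h2 : ∀ x, x ≠ u → x ≠ v → (G.graph.neighborSet x).ncard = 2) :
    ∃ a b c, G.IsIsomorphic (theta 2 0 2 a b c) := by
  have hs : ∀ a b, G.graph.Adj a b → G.graph.Adj b a := fun _ _ h => h.symm
  have hi : ∀ a, ¬ G.graph.Adj a a := fun _ => G.graph.irrefl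
  have e1 := exists_adj_of_no_common_neighbor hr hvx hvz hux' huz' hxz' h11 h12 h21 h22 hu hv h2
  have e2 := exists_adj_of_no_common_neighbor hr hvz hvx hux' huz' hxz' h21 h22 h11 h12
    (by grind) hv h2
  have ux : G.graph.Adj u x := by simp [hu]
  have uz : G.graph.Adj u z := by simp [hu]
  have vx' : G.graph.Adj v x' := by simp [hv]
  have vz' : G.graph.Adj v z' := by simp [hv]
  obtain ⟨a, hau, ka, ha⟩ := exists_neighbor_of_ncard_two (h2 x (by grind) hvx.symm) ux.symm
  obtain ⟨b, hbu, kb, hb⟩ := exists_neighbor_of_ncard_two (h2 z (by grind) hvz.symm) uz.symm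
  obtain ⟨c, hcv, kc, hc⟩ := exists_neighbor_of_ncard_two (h2 x' hux'.symm (by grind)) vx'.symm
  obtain ⟨d, hdv, kd, hd⟩ := exists_neighbor_of_ncard_two (h2 z' huz'.symm (by grind)) vz'.symm
  rcases e1 with e1 | e1
  · obtain rfl : a = x' := by grind
    obtain rfl : c = x := by grind
    -- The neighbours of `x'` are already `v` and `x`, so `z` is left with `z'`.
    have e3 : G.graph.Adj z z' := by grind
    obtain rfl : b = z' := by grind
    obtain rfl : d = z := by grind
    exact exists_isIsomorphic_theta_two_zero_two hG hxz hxz' h12 (Ne.symm h21) hux' huz' hvx hvz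
      hu hv ha hc hb hd
  · obtain rfl : a = z' := by grind
    obtain rfl : d = x := by grind
    have e3 : G.graph.Adj z x' := by grind
    obtain rfl : b = x' := by grind
    obtain rfl : c = z := by grind
    exact exists_isIsomorphic_theta_two_zero_two hG hxz hxz'.symm h11 (Ne.symm h22) huz' hux' hvx
      hvz hu (by grind) ha hd hb hc

theorem exists_theta_of_adj (hG : G.graph.Connected) (hr : G.rank < 5) {u v : V}
    (huv : G.graph.Adj u v) (hu3 : (G.graph.neighborSet u).ncard = 3)
    (hv3 : (G.graph.neighborSet v).ncard = 3)
    (h2 : ∀ x, x ≠ u → x ≠ v → (G.graph.neighborSet x).ncard = 2) :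
    (∃ a b c, G.IsIsomorphic (theta 1 0 1 a b c)) ∨
      (∃ a b c, G.IsIsomorphic (theta 1 0 2 a b c)) ∨
        ∃ a b c, G.IsIsomorphic (theta 2 0 2 a b c) := by
  obtain ⟨x, z, hvx, hvz, hxz, hu⟩ := exists_neighbors_of_ncard_three' hu3 huv
  obtain ⟨x', z', hux', huz', hxz', hv⟩ := exists_neighbors_of_ncard_three' hv3 huv.symm
  by_cases h11 : x = x'
  · subst h11
    exact (exists_theta_of_common_neighbor hG hr hvx hvz hxz hux' huz' hxz' hu hv h2).imp_right Or.inl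
  by_cases h12 : x = z'
  · subst h12
    exact (exists_theta_of_common_neighbor hG hr hvx hvz hxz huz' hux' hxz'.symm hu (by grind) h2).imp_right Or.inl
  by_cases h21 : z = x'
  · subst h21
    exact (exists_theta_of_common_neighbor hG hr hvz hvx hxz.symm hux' huz' hxz' (by grind) hv h2).imp_right Or.inl
  by_cases h22 : z = z'
  · subst h22
    exact (exists_theta_of_common_neighbor hG hr hvz hvx hxz.symm huz' hux' hxz'.symm (by grind)
      (by grind) h2).imp_right Or.inl
  exact Or.inr (Or.inr (exists_theta_of_no_common_neighbor hG hr hvx hvz hxz hux' huz' hxz' h11 h12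
    h21 h22 hu hv h2))

/-- In the case of two nonadjacent vertices `u`, `v` of degree `3`, the neighbors of `u` are
adjacent to `v`. -/
theorem neighbor_of_not_adj (hr : G.rank < 5) {u v a b c : V} (hne : u ≠ v)
    (huv : ¬ G.graph.Adj u v) (hab : a ≠ b) (hac : a ≠ c) (hbc : b ≠ c)
    (hu : ∀ w, G.graph.Adj u w ↔ w = a ∨ w = b ∨ w = c)
    (hv3 : (G.graph.neighborSet v).ncard = 3)
    (h2 : ∀ x, x ≠ u → x ≠ v → (G.graph.neighborSet x).ncard = 2) :
    ∀ w, G.graph.Adj a w ↔ w = u ∨ w = v := by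
  have hs : ∀ a b, G.graph.Adj a b → G.graph.Adj b a := fun _ _ h => h.symm
  have hi : ∀ a, ¬ G.graph.Adj a a := fun _ => G.graph.irrefl
  have ua : G.graph.Adj u a := by simp [hu]
  have ub : G.graph.Adj u b := by simp [hu]
  have uc : G.graph.Adj u c := by simp [hu]
  obtain ⟨m, hmu, am, ha⟩ := exists_neighbor_of_ncard_two (h2 a (by grind) (by grind)) ua.symm
  obtain ⟨mb, hmbu, bmb, hb⟩ := exists_neighbor_of_ncard_two (h2 b (by grind) (by grind)) ub.symm
  obtain ⟨mc, hmcu, cmc, hc⟩ := exists_neighbor_of_ncard_two (h2 c (by grind) (by grind)) uc.symm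
  have tab : ¬ G.graph.Adj a b := fun h => hr.not_ge <|
    five_le_rank_of_triangle_three (u := u) (a := a) (b := b) (c := c) hu
      (h2 a (by grind) (by grind)) (h2 b (by grind) (by grind)) h cmc (by grind) (by grind) hmcu
  have tac : ¬ G.graph.Adj a c := fun h => hr.not_ge <|
    five_le_rank_of_triangle_three (u := u) (a := a) (b := c) (c := b) (by grind)
      (h2 a (by grind) (by grind)) (h2 c (by grind) (by grind)) h bmb (by grind) (by grind) hmbu
  have tbc : ¬ G.graph.Adj b c := fun h => hr.not_ge <|
    five_le_rank_of_triangle_three (u := u) (a := b) (b := c) (c := a) (by grind)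
      (h2 b (by grind) (by grind)) (h2 c (by grind) (by grind)) h am (by grind) (by grind) hmu
  by_cases hmv : m = v
  · rwa [hmv] at ha
  exfalso
  obtain ⟨k, hka, mk', hm⟩ := exists_neighbor_of_ncard_two (h2 m hmu hmv) am.symm
  -- Here `u a m b` is a 4-cycle closed without meeting `v`. The third edge at `u` leads through `c`
  -- to `mc` and on to some `r`; omitting `b` makes `m` pendant at `a`, and the edges `m a`, `u c`,
  -- `mc r` can be eliminated in this order.
  have loop : ∀ b c mc, G.graph.Adj u c → (∀ w, G.graph.Adj u w ↔ w = a ∨ w = b ∨ w = c) →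
      ¬ G.graph.Adj a c → ¬ G.graph.Adj b c → G.graph.Adj c mc → mc ≠ u → c ≠ b →
      a ≠ c → (∀ w, G.graph.Adj b w ↔ w = u ∨ w = m) → k = b → False := by
    intro b c mc uc hu tac tbc cmc hmcu hcb hac hb hkb
    subst hkb
    obtain ⟨r, hrc, mcr⟩ : ∃ r, r ≠ c ∧ G.graph.Adj mc r := by
      by_cases hmcv : mc = v
      · obtain ⟨p, q, r, hpq, -, -, hp⟩ := exists_neighbors_of_ncard_three hv3
        have vp : G.graph.Adj v p := by simp [hp]
        have vq : G.graph.Adj v q := by simp [hp]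
        subst hmcv
        by_cases hpc : p = c
        · exact ⟨q, by grind, vq⟩
        · exact ⟨p, hpc, vp⟩
      · obtain ⟨r, hrc, h, -⟩ := exists_neighbor_of_ncard_two (h2 mc hmcu hmcv) cmc.symm
        exact ⟨r, hrc, h⟩
    have hmcm : mc ≠ m := by grind
    have := six_le_rank_of_pendant_elimination (G := G) (p₁ := m) (p₂ := a) (p₃ := u)
      (p₄ := c) (p₅ := mc) (p₆ := r) (by grind) (by grind) (by grind) (by grind) (by grind)
      (by grind) (by grind) (by grind) (by grind)
    omega
  by_cases hku : G.graph.Adj k u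
  · have : k = b ∨ k = c := by grind
    rcases this with rfl | rfl
    · refine loop k c mc uc hu tac tbc cmc hmcu (by grind) hac ?_ rfl
      obtain rfl : mb = m := by grind
      exact hb
    · refine loop k b mb ub (by grind) tab (by grind) bmb hmbu (by grind) hab ?_ rfl
      obtain rfl : mc = m := by grind
      exact hc
  · exact hr.not_ge (five_le_rank_of_path (u := u) (n₁ := a) (n₂ := b) (m := m) (k := k)
      (m₂ := mb) ub hab.symm (by grind) ha hm (by grind) hku bmb hmbu (by grind))

/-- By `neighbor_of_not_adj` all three neighbours of `u` are joined to `v`; since `v` has degree 3,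
they exhaust its neighbourhood. -/
theorem exists_theta_of_not_adj (hG : G.graph.Connected) (hr : G.rank < 5) {u v : V}
    (hne : u ≠ v) (huv : ¬ G.graph.Adj u v) (hu3 : (G.graph.neighborSet u).ncard = 3)
    (hv3 : (G.graph.neighborSet v).ncard = 3)
    (h2 : ∀ x, x ≠ u → x ≠ v → (G.graph.neighborSet x).ncard = 2) :
    ∃ a b c, G.IsIsomorphic (theta 1 1 1 a b c) := by
  obtain ⟨a, b, c, hab, hac, hbc, hu⟩ := exists_neighbors_of_ncard_three hu3
  have ha := neighbor_of_not_adj hr hne huv hab hac hbc hu hv3 h2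
  have hb := neighbor_of_not_adj hr hne huv hab.symm hbc hac (by grind) hv3 h2
  have hc := neighbor_of_not_adj hr hne huv hac.symm hbc.symm hab (by grind) hv3 h2
  have hsub : ({a, b, c} : Set V) ⊆ G.graph.neighborSet v := by
    rintro w (rfl | rfl | rfl)
    · exact ((ha v).2 (Or.inr rfl)).symm
    · exact ((hb v).2 (Or.inr rfl)).symm
    · exact ((hc v).2 (Or.inr rfl)).symm
  have heq := Set.eq_of_subset_of_ncard_le hsub
    (by rw [hv3, Set.ncard_eq_three.2 ⟨a, b, c, hab, hac, hbc, rfl⟩]) (Set.toFinite _)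
  have hv : ∀ w, G.graph.Adj v w ↔ w = a ∨ w = b ∨ w = c := fun w => by
    simpa using (Set.ext_iff.1 heq w).symm
  exact exists_isIsomorphic_theta_one_one_one hG hne hab hac hbc hu hv ha hb hc

end Classification

end WeightedGraph

/-- The weights `a₁, a₂, …` are written `a 0, a 1, …`, and similarly for `b` and `c`. -/
theorem theorem5p3 {V : Type*} [Fintype V] (G : WeightedGraph V)
    (hG : G.IsBicyclic) (hp : ¬ G.HasPendant) :
    G.rank = 4 ↔
      (∃ (a : Fin 4 → {x : ℝ // 0 < x}) (b : Fin 4 → {x : ℝ // 0 < x})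
          (c : Fin 0 → {x : ℝ // 0 < x}),
        G.IsIsomorphic (WeightedGraph.infty 4 1 4 a b c) ∧
          (a 0 : ℝ) * a 2 = a 1 * a 3 ∧ (b 0 : ℝ) * b 2 = b 1 * b 3) ∨
      (∃ (a : Fin 2 → {x : ℝ // 0 < x}) (b : Fin 2 → {x : ℝ // 0 < x})
          (c : Fin 2 → {x : ℝ // 0 < x}),
        G.IsIsomorphic (WeightedGraph.theta 1 1 1 a b c) ∧
          ((a 1 : ℝ) * b 0 ≠ a 0 * b 1 ∨ (a 1 : ℝ) * c 0 ≠ a 0 * c 1)) ∨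
      (∃ (a : Fin 2 → {x : ℝ // 0 < x}) (b : Fin 1 → {x : ℝ // 0 < x})
          (c : Fin 2 → {x : ℝ // 0 < x}),
        G.IsIsomorphic (WeightedGraph.theta 1 0 1 a b c) ∧
          (a 1 : ℝ) * c 0 ≠ a 0 * c 1) ∨
      (∃ (a : Fin 2 → {x : ℝ // 0 < x}) (b : Fin 1 → {x : ℝ // 0 < x})
          (c : Fin 3 → {x : ℝ // 0 < x}),
        G.IsIsomorphic (WeightedGraph.theta 1 0 2 a b c) ∧
          (b 0 : ℝ) * c 1 = c 0 * c 2) ∨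
      (∃ (a : Fin 3 → {x : ℝ // 0 < x}) (b : Fin 1 → {x : ℝ // 0 < x})
          (c : Fin 3 → {x : ℝ // 0 < x}),
        G.IsIsomorphic (WeightedGraph.theta 2 0 2 a b c) ∧
          (a 1 : ℝ) * b 0 * c 1 - a 0 * a 2 * c 1 - a 1 * c 0 * c 2 = 0) := by
  constructor
  · intro h4
    have hr : G.rank < 5 := by omega
    rcases WeightedGraph.degrees_of_bicyclic hG hp with
      ⟨u, hu, h2⟩ | ⟨u, v, hne, hu, hv, h2⟩
    · obtain ⟨a, b, c, h⟩ := WeightedGraph.exists_infty_of_ncard_four hG.1 hr hu h2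
      exact .inl ⟨a, b, c, h, h.rank_infty_four_one_four.1 h4⟩
    by_cases huv : G.graph.Adj u v
    · rcases WeightedGraph.exists_theta_of_adj hG.1 hr huv hu hv h2 with
        ⟨a, b, c, h⟩ | ⟨a, b, c, h⟩ | ⟨a, b, c, h⟩
      · exact .inr (.inr (.inl ⟨a, b, c, h, h.rank_theta_one_zero_one.1 h4⟩))
      · exact .inr (.inr (.inr (.inl ⟨a, b, c, h, h.rank_theta_one_zero_two.1 h4⟩)))
      · exact .inr (.inr (.inr (.inr ⟨a, b, c, h, h.rank_theta_two_zero_two.1 h4⟩)))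
    · obtain ⟨a, b, c, h⟩ := WeightedGraph.exists_theta_of_not_adj hG.1 hr hne huv hu hv h2
      exact .inr (.inl ⟨a, b, c, h, h.rank_theta_one_one_one.1 h4⟩)
  · rintro (⟨a, b, c, h, hw⟩ | ⟨a, b, c, h, hw⟩ | ⟨a, b, c, h, hw⟩ | ⟨a, b, c, h, hw⟩ |
      ⟨a, b, c, h, hw⟩)
    · exact h.rank_infty_four_one_four.2 hw
    · exact h.rank_theta_one_one_one.2 hw
    · exact h.rank_theta_one_zero_one.2 hw
    · exact h.rank_theta_one_zero_two.2 hw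
    · exact h.rank_theta_two_zero_two.2 hw
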